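/- **Setting.** Let $\Lambda\subset J^1(S^1)=S^1_x\times\mathbb{R}^2_{y,z}$, with contact structure $\ker(dz-y\,dx)$, be an oriented Legendrian link, given by a generic front diagram in the $xz$-cylinder. Cut the front at slices $x_0,\dots,x_{M-1}$, cyclically ordered with $x_M=x_0$, so that between consecutive slices there is at most one crossing or cusp. Let $N(m)$ be the number of strands at $x_m$, numbered $1,\dots,N(m)$ from top to bottom. A *generalized normal ruling* is a family of involutions $\sigma_m$ of $\{1,\dots,N(m)\}$ for all $m$, with $\sigma_M=\sigma_0$, such that: $\sigma_m=\sigma_{m-1}$ if there is no crossing or cusp between $x_{m-1}$ and $x_m$; at a left or right cusp of strands $\ell,\ell+1$ the involution pairs $\ell$ with $\ell+1$ on the side where these strands exist, and is otherwise unchanged up to the renumbering of the strands; at a crossing of strands $\ell,\ell+1$ we have $\sigma_{m-1}(\ell)\ne\ell+1$, and either $\sigma_m=(\ell\ \,\ell{+}1)\circ\sigma_{m-1}\circ(\ell\ \,\ell{+}1)$, or $\sigma_m=\sigma_{m-1}$ (a switch) and one of $$\sigma_m(\ell+1)<\sigma_m(\ell)<\ell,\qquad \sigma_m(\ell)<\ell<\ell+1<\sigma_m(\ell+1),\qquad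 \ell+1<\sigma_m(\ell+1)<\sigma_m(\ell),$$ $$\sigma_m(\ell)=\ell<\ell+1<\sigma_m(\ell+1),\qquad \sigma_m(\ell)<\ell<\ell+1=\sigma_m(\ell+1)$$ holds. It is *strictly generalized* if some $\sigma_m$ has a fixed point (a self-paired strand). Place $s$ base points, labelled $t_1,\dots,t_s$, on $\Lambda$ (on strands, or on the loops of resolved right cusps), at least one on each component, and fix a Maslov potential $\mu$ with values in $\mathbb{Z}/2r$, even exactly on the strands oriented to the right. Let $(\mathcal{A},\partial)$ be the Chekanov–Eliashberg DGA of the dipped diagram (the resolution of the front, with a dip at each slice): $\mathcal{A}$ is the tensor algebra over $\mathbb{Z}[t_1^{\pm1},\dots,t_s^{\pm1}]$ generated by $a_m$ for each crossing or right cusp between $x_{m-1}$ and $x_m$, and by $b^m_{ij},c^m_{ij}$ for $1\le i<j\le N(m)$. Degrees are $|a_m|=\mu(\ell)-\mu(\ell+1)$ at a crossing of $\ell,\ell+1$ (potentials taken at $x_{m-1}$), $|a_m|=1$ at a right cusp, $|b^m_{ij}|=\mu(i)-\mu(j)$ and $|c^m_{ij}|=\mu(i)-\mu(j)-1$. With the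 strictly upper triangular matrices $B_m=(b^m_{ij})$, $C_m=(c^m_{ij})$ and $\Sigma_m=\mathrm{diag}((-1)^{\mu(i)})$, the differential is $$\partial C_m=(\Sigma_m C_m)^2,\qquad \partial B_m=-\Sigma_m(I+B_m)\Sigma_m C_m+\widetilde C_{m-1}(I+B_m),$$ extended by $\partial(xy)=(\partial x)y+(-1)^{|x|}x\,\partial y$ and $\partial t_q=0$. Here let $C'=\Delta C_{m-1}\Delta^{-1}$, where $\Delta$ is diagonal with $i$-th entry the product of $t_q^{-1}$ (strand $i$ oriented to the right) or $t_q$ (oriented to the left) over the base points $q$ on strand $i$ at $x_{m-1}$. If nothing happens between $x_{m-1}$ and $x_m$, then $\widetilde C_{m-1}=C'$. At a crossing of $\ell,\ell+1$, $\partial a_m=C'_{\ell,\ell+1}$ and $\widetilde C_{m-1}=U\widehat C V$, where $\widehat C$ is $C'$ with the entry at $(\ell,\ell+1)$ replaced by $0$, and $U,V$ are identity matrices with the blocks $\begin{pmatrix}0&1\\1&(-1)^{|a_m|+1}a_m\end{pmatrix}$, $\begin{pmatrix}a_m&1\\1&0\end{pmatrix}$ in rows and columns $\ell,\ell+1$.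 At a left cusp $\ell,\ell+1$, $\widetilde C_{m-1}$ is $C'$ with two new rows and columns $\ell,\ell+1$ that vanish except for the entry $1$ at $(\ell,\ell+1)$. At a right cusp $\ell,\ell+1$, $\partial a_m=\tau+C'_{\ell,\ell+1}$, where $\tau$ is the product of the $t_q$ ($t_q^{-1}$ if strand $\ell$ is oriented to the left) over the base points on the loop, and $\widetilde C_{m-1}$ has the entries $$C'_{ij}+\tau^{-1}(C'_{i,\ell+1}+C'_{i\ell}a_m)(C'_{\ell j}+a_mC'_{\ell+1,j}),\qquad i,j\notin\{\ell,\ell+1\}$$ (the second summand vanishes if the cusp joins the two lowest strands). An *augmentation* of $(\mathcal{A},\partial)$ to a field $F$ is a unital ring homomorphism $\epsilon:\mathcal{A}\to F$ with $\epsilon\circ\partial=0$. **Proposition.** If the front of $\Lambda$ has a strictly generalized normal ruling and $F$ is a field, then for every $0\ne x\in F$ there is an augmentation $\epsilon:\mathcal{A}\to F$ with $\epsilon(t_1\cdots t_s)=x$. -/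

import Mathlib

/-!
Legendrian links in `J¹(S¹)` through their front diagrams, generalized normal rulings, and the
Chekanov-Eliashberg DGA over `ℤ[t₁^{±1}, …, t_s^{±1}]` of the dipped diagram.

Strands over a slice of the front are numbered from top to bottom, starting with `0`.
-/

namespace SolidTorus

/-! ### Front diagrams -/

/-- The elementary tangles of a front, from `n` strands on the left to `n'` strands on the right.
A crossing or a cusp at `k` involves the neighbouring strands `k` (`Fin.castSucc k`) and `k + 1`
(`Fin.succ k`). `trivial` is a slab without crossing or cusp; it is needed for fronts that have
neither. -/
inductive Event : ℕ → ℕ → Type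
  | trivial (n : ℕ) : Event n n
  | crossing (n : ℕ) (k : Fin (n + 1)) : Event (n + 2) (n + 2)
  | leftCusp (n : ℕ) (k : Fin (n + 1)) : Event n (n + 2)
  | rightCusp (n : ℕ) (k : Fin (n + 1)) : Event (n + 2) n

/-- The increasing map `Fin n → Fin (n + 2)` that misses exactly `k` and `k + 1`. -/
def skip {n : ℕ} (k : Fin (n + 1)) (i : Fin n) : Fin (n + 2) :=
  k.succ.succAbove (k.succAbove i)

/-- The transposition `(k  k+1)`. -/
def transp {n : ℕ} (k : Fin (n + 1)) : Equiv.Perm (Fin (n + 2)) :=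
  Equiv.swap k.castSucc k.succ

namespace Event

/-- Strand `i` on the left and strand `j` on the right of the event are connected through it. -/
def Through : {n n' : ℕ} → Event n n' → Fin n → Fin n' → Prop
  | _, _, trivial _, i, j => j = i
  | _, _, crossing _ k, i, j => j = transp k i
  | _, _, leftCusp _ k, i, j => j = skip k i
  | _, _, rightCusp _ k, i, j => i = skip k j

/-- The event is a left cusp, born with upper strand `i` and lower strand `j`. -/
def LeftCuspAt : {n n' : ℕ} → Event n n' → Fin n' → Fin n' → Prop
  | _, _, leftCusp _ k, i, j => i = k.castSucc ∧ j = k.succ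
  | _, _, _, _, _ => False

/-- The event is a right cusp, ending the upper strand `i` and the lower strand `j`. -/
def RightCuspAt : {n n' : ℕ} → Event n n' → Fin n → Fin n → Prop
  | _, _, rightCusp _ k, i, j => i = k.castSucc ∧ j = k.succ
  | _, _, _, _, _ => False

/-- The event gives a crossing of the resolved diagram: it is a crossing or a right cusp. -/
def HasGenerator : {n n' : ℕ} → Event n n' → Prop
  | _, _, crossing _ _ => True
  | _, _, rightCusp _ _ => True
  | _, _, _ => False

end Event

/-- A front diagram in `S¹ × ℝ`, cut into slabs with at most one crossing or cusp each.
There are `M + 1` slices, numbered cyclically by `Fin (M + 1)`; there are `N m` strands over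
slice `m`, and `event m` lies between slice `m` and slice `m + 1`. -/
structure Front where
  M : ℕ
  N : Fin (M + 1) → ℕ
  event : (m : Fin (M + 1)) → Event (N m) (N (m + 1))

namespace Front

/-- The strands over the slices. -/
abbrev Strand (D : Front) : Type := Σ m : Fin (D.M + 1), Fin (D.N m)

/-- Two pieces of strand that are adjacent on the link. -/
inductive Adj (D : Front) : D.Strand → D.Strand → Prop
  | through (m : Fin (D.M + 1)) (i : Fin (D.N m)) (j : Fin (D.N (m + 1))) :
      (D.event m).Through i j → Adj D ⟨m, i⟩ ⟨m + 1, j⟩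
  | left (m : Fin (D.M + 1)) (i j : Fin (D.N (m + 1))) :
      (D.event m).LeftCuspAt i j → Adj D ⟨m + 1, i⟩ ⟨m + 1, j⟩
  | right (m : Fin (D.M + 1)) (i j : Fin (D.N m)) :
      (D.event m).RightCuspAt i j → Adj D ⟨m, i⟩ ⟨m, j⟩

/-- Two strands belong to the same component of the link. -/
def SameComponent (D : Front) : D.Strand → D.Strand → Prop :=
  Relation.EqvGen D.Adj

/-- A Maslov potential with values in `ℤ / 2r`. It also fixes the orientation of the link: a strand
is oriented to the right if its potential is even, and to the left if it is odd. -/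
structure MaslovPotential (D : Front) (r : ℕ) where
  val : (m : Fin (D.M + 1)) → Fin (D.N m) → ZMod (2 * r)
  through : ∀ m i j, (D.event m).Through i j → val (m + 1) j = val m i
  left : ∀ m i j, (D.event m).LeftCuspAt i j → val (m + 1) i = val (m + 1) j + 1
  right : ∀ m i j, (D.event m).RightCuspAt i j → val m i = val m j + 1

/-- The places for a base point: on a strand `i` at slice `m` (to the right of the dip there and
to the left of `event m`), or on the loop of the resolution of a right cusp `event m` with upper
strand `i` and lower strand `j`. -/
inductive Site (D : Front) : Type
  | strand (m : Fin (D.M + 1)) (i : Fin (D.N m)) : Site D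
  | loop (m : Fin (D.M + 1)) (i j : Fin (D.N m)) (h : (D.event m).RightCuspAt i j) : Site D

/-- A strand on the component that a site lies on. -/
def Site.toStrand {D : Front} : D.Site → D.Strand
  | strand m i => ⟨m, i⟩
  | loop m i _ _ => ⟨m, i⟩

/-- `s` base points, at least one on each component of the link. -/
structure BasePoints (D : Front) (s : ℕ) where
  pos : Fin s → D.Site
  exists_mem : ∀ p : D.Strand, ∃ q : Fin s, D.SameComponent p (pos q).toStrand

end Front

/-! ### Generalized normal rulings -/

/-- The normality condition at a switched crossing of the strands `k` and `k + 1`. The first three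
cases are those of two paired crossing strands, the last two those of exactly one self-paired
crossing strand. -/
def Normality {n : ℕ} (k : Fin (n + 1)) (σ : Fin (n + 2) → Fin (n + 2)) : Prop :=
  (σ k.succ < σ k.castSucc ∧ σ k.castSucc < k.castSucc) ∨
  (σ k.castSucc < k.castSucc ∧ k.succ < σ k.succ) ∨
  (k.succ < σ k.succ ∧ σ k.succ < σ k.castSucc) ∨
  (σ k.castSucc = k.castSucc ∧ k.succ < σ k.succ) ∨
  (σ k.castSucc < k.castSucc ∧ σ k.succ = k.succ)

/-- The condition of a generalized normal ruling on the involutions `σ` to the left and `σ'` to the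
right of an event. -/
def Event.RulingStep : {n n' : ℕ} → Event n n' → (Fin n → Fin n) → (Fin n' → Fin n') → Prop
  | _, _, .trivial _, σ, σ' => σ' = σ
  | _, _, .crossing _ k, σ, σ' =>
      σ k.castSucc ≠ k.succ ∧
        (σ' = transp k ∘ σ ∘ transp k ∨ (σ' = σ ∧ Normality k σ))
  | _, _, .leftCusp _ k, σ, σ' =>
      σ' k.castSucc = k.succ ∧ ∀ i, σ' (skip k i) = skip k (σ i)
  | _, _, .rightCusp _ k, σ, σ' =>
      σ k.castSucc = k.succ ∧ ∀ i, σ (skip k i) = skip k (σ' i)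

/-- Generalized normal rulings of a front in `J¹(S¹)`. -/
structure Front.GeneralizedNormalRuling (D : Front) where
  σ : (m : Fin (D.M + 1)) → Fin (D.N m) → Fin (D.N m)
  involutive : ∀ m, Function.Involutive (σ m)
  step : ∀ m, (D.event m).RulingStep (σ m) (σ (m + 1))

/-- A strictly generalized normal ruling has a self-paired strand. -/
def Front.GeneralizedNormalRuling.IsStrict {D : Front} (R : D.GeneralizedNormalRuling) : Prop :=
  ∃ (m : Fin (D.M + 1)) (i : Fin (D.N m)), R.σ m i = i

/-! ### Coefficients, and differentials on free algebras -/

/-- The Laurent polynomial ring `ℤ[t₁^{±1}, …, t_s^{±1}]`. -/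
abbrev Laurent (s : ℕ) : Type := AddMonoidAlgebra ℤ (Fin s → ℤ)

/-- The monomial `t₁^{v₁} ⋯ t_s^{v_s}`. -/
noncomputable def mono {s : ℕ} (v : Fin s → ℤ) : Laurent s := AddMonoidAlgebra.single v 1

/-- The variable `t_q`. -/
noncomputable def tVar {s : ℕ} (q : Fin s) : Laurent s := mono (Pi.single q 1)

/-- The sign `(-1)^d` of a degree `d ∈ ℤ / 2r`. -/
def sgn {r : ℕ} (d : ZMod (2 * r)) : ℤ :=
  if ZMod.castHom (Dvd.intro r rfl) (ZMod 2) d = 0 then 1 else -1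

section FreeDifferential

variable {R X : Type} [CommRing R] (sg : X → ℤ) (d : X → FreeAlgebra R X)

/-- The algebra map sending a generator `g` to `[[sg g • g, d g], [0, g]]`. -/
noncomputable def leibnizHom :
    FreeAlgebra R X →ₐ[R] Matrix (Fin 2) (Fin 2) (FreeAlgebra R X) :=
  FreeAlgebra.lift R fun g =>
    !![sg g • FreeAlgebra.ι R g, d g; 0, FreeAlgebra.ι R g]

/-- The algebra automorphism `x ↦ (-1)^{|x|} x`, where `sg g = (-1)^{|g|}` on generators. -/
noncomputable def signMap : FreeAlgebra R X →ₐ[R] FreeAlgebra R X :=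
  FreeAlgebra.lift R fun g => sg g • FreeAlgebra.ι R g

/-- The extension of `d` from the generators to the free algebra by the signed Leibniz rule
`∂(xy) = (∂x) y + (-1)^{|x|} x (∂y)`, with `∂ = 0` on the coefficients; see the lemmas
`extend_ι`, `extend_algebraMap` and `extend_mul`. -/
noncomputable def extend (x : FreeAlgebra R X) : FreeAlgebra R X := leibnizHom sg d x 0 1

theorem leibnizHom_entries (x : FreeAlgebra R X) :
    leibnizHom sg d x 0 0 = signMap sg x ∧ leibnizHom sg d x 1 0 = 0 ∧
      leibnizHom sg d x 1 1 = x := by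
  induction x using FreeAlgebra.induction with
  | grade0 r => simp [Matrix.algebraMap_eq_diagonal]
  | grade1 g => simp [leibnizHom, signMap]
  | mul a b ha hb =>
      simp only [map_mul, Matrix.mul_apply, Fin.sum_univ_two, ha.1, ha.2.1, ha.2.2, hb.1, hb.2.1,
        hb.2.2]
      simp
  | add a b ha hb => simp [ha.1, ha.2.1, ha.2.2, hb.1, hb.2.1, hb.2.2]

theorem extend_ι (g : X) : extend sg d (FreeAlgebra.ι R g) = d g := by
  simp [extend, leibnizHom]

theorem extend_algebraMap (r : R) : extend sg d (algebraMap R (FreeAlgebra R X) r) = 0 := by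
  simp [extend, Matrix.algebraMap_eq_diagonal]

theorem extend_add (x y : FreeAlgebra R X) :
    extend sg d (x + y) = extend sg d x + extend sg d y := by
  simp [extend]

theorem extend_mul (x y : FreeAlgebra R X) :
    extend sg d (x * y) = extend sg d x * y + signMap sg x * extend sg d y := by
  simp only [extend, map_mul, Matrix.mul_apply, Fin.sum_univ_two, (leibnizHom_entries sg d x).1,
    (leibnizHom_entries sg d y).2.2]
  rw [add_comm]

end FreeDifferential

/-! ### The DGA of the dipped diagram -/

/-- The differential of the generator `a` at an event, where `C` is the matrix entering from the
left and `τ` is the monomial of the base points on the loop of a right cusp: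
`c_{k,k+1}` at a crossing, `τ + c_{k,k+1}` at a right cusp. -/
def Event.boundary {A : Type} [Ring A] (τ : A) :
    {n n' : ℕ} → Event n n' → Matrix (Fin n) (Fin n) A → A
  | _, _, .crossing _ k, C => C k.castSucc k.succ
  | _, _, .rightCusp _ k, C => τ + C k.castSucc k.succ
  | _, _, _, _ => 0

/-- The matrix `C̃` leaving an event to the right, where `C` is the matrix entering from the left,
`a` is the generator of the event, `sa = (-1)^{|a|}`, and `τ'` is the inverse of the monomial of
the base points on the loop of a right cusp.

* At a crossing, `C̃ = U Ĉ V`, where `Ĉ` is `C` with its entry at `(k, k+1)` replaced by `0`, and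
  `U`, `V` are the identity except for the blocks `[[0, 1], [1, -(-1)^{|a|} a]]` and
  `[[a, 1], [1, 0]]` in the rows and columns `k, k+1`.
* At a left cusp, two rows and columns are inserted, with the entry `1` at `(k, k+1)`.
* At a right cusp, the rows and columns `k, k+1` are removed. The further term counts the disks
  from a strand above to a strand below the cusp whose boundary runs around the loop; as `C` is
  strictly upper triangular, it vanishes if the cusp involves the two lowest strands. -/
def Event.outgoing {A : Type} [Ring A] (a : A) (sa : ℤ) (τ' : A) :
    {n n' : ℕ} → Event n n' → Matrix (Fin n) (Fin n) A → Matrix (Fin n') (Fin n') A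
  | _, _, .trivial _, C => C
  | _, _, .crossing _ k, C =>
      let p := k.castSucc
      let q := k.succ
      let Chat := C.updateRow p (Function.update (C p) q 0)
      let U : Matrix _ _ A := fun i j =>
        if i = p then (if j = q then 1 else 0)
        else if i = q then (if j = p then 1 else if j = q then -(sa • a) else 0)
        else if i = j then 1 else 0
      let V : Matrix _ _ A := fun i j =>
        if i = p then (if j = p then a else if j = q then 1 else 0)
        else if i = q then (if j = p then 1 else 0)
        else if i = j then 1 else 0
      U * Chat * V
  | _, _, .leftCusp n k, C =>
      let J : Matrix (Fin (n + 2)) (Fin n) A := fun i j => if i = skip k j then 1 else 0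
      J * C * J.transpose + Matrix.single k.castSucc k.succ 1
  | _, _, .rightCusp _ k, C => fun i j =>
      C (skip k i) (skip k j) +
        τ' * (C (skip k i) k.succ + C (skip k i) k.castSucc * a) *
          (C k.castSucc (skip k j) + a * C k.succ (skip k j))

/-- The degree of the generator of an event, in terms of the Maslov potential on its left. -/
def Event.degree {r : ℕ} : {n n' : ℕ} → Event n n' → (Fin n → ZMod (2 * r)) → ZMod (2 * r)
  | _, _, .crossing _ k, μ => μ k.castSucc - μ k.succ
  | _, _, .rightCusp _ _, _ => 1
  | _, _, _, _ => 0

namespace Front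

/-- The generators of the DGA of the dipped diagram: the crossings `a` of the resolved front, and
the crossings of the dips, one dip at each slice. The generators `c m i j` belong to the dip at
slice `m` and the generators `b m i j` to the dip at slice `m + 1`, for strands `i < j`. -/
inductive Gen (D : Front) : Type
  | a (m : Fin (D.M + 1)) (h : (D.event m).HasGenerator) : Gen D
  | b (m : Fin (D.M + 1)) (i j : Fin (D.N (m + 1))) (h : i < j) : Gen D
  | c (m : Fin (D.M + 1)) (i j : Fin (D.N m)) (h : i < j) : Gen D

/-- The degree of a generator. -/
def degree {D : Front} {r : ℕ} (μ : D.MaslovPotential r) : D.Gen → ZMod (2 * r)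
  | .a m _ => (D.event m).degree (μ.val m)
  | .b m i j _ => μ.val (m + 1) i - μ.val (m + 1) j
  | .c m i j _ => μ.val m i - μ.val m j - 1

/-- The underlying algebra: the tensor algebra over `ℤ[t₁^{±1}, …, t_s^{±1}]` on the generators. -/
abbrev Alg (D : Front) (s : ℕ) : Type := FreeAlgebra (Laurent s) D.Gen

section DGA

variable (D : Front) {r s : ℕ} (μ : D.MaslovPotential r) (P : D.BasePoints s)

open Classical in
/-- The generator of `event m`, or `0` if there is none. -/
noncomputable def aGen (s : ℕ) (m : Fin (D.M + 1)) : D.Alg s :=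
  if h : (D.event m).HasGenerator then FreeAlgebra.ι _ (Gen.a m h) else 0

/-- The strictly upper triangular matrix of the generators `b` in the dip at slice `m + 1`. -/
noncomputable def matB (s : ℕ) (m : Fin (D.M + 1)) :
    Matrix (Fin (D.N (m + 1))) (Fin (D.N (m + 1))) (D.Alg s) :=
  fun i j => if h : i < j then FreeAlgebra.ι _ (Gen.b m i j h) else 0

/-- The strictly upper triangular matrix of the generators `c` in the dip at slice `m`. -/
noncomputable def matC (s : ℕ) (m : Fin (D.M + 1)) :
    Matrix (Fin (D.N m)) (Fin (D.N m)) (D.Alg s) :=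
  fun i j => if h : i < j then FreeAlgebra.ι _ (Gen.c m i j h) else 0

variable {D}

open Classical in
/-- The exponents of the base points on strand `i` at slice `m`, for a path along the strand to the
right: `+1` if the strand is oriented to the right, `-1` if it is oriented to the left. -/
noncomputable def strandExp (m : Fin (D.M + 1)) (i : Fin (D.N m)) : Fin s → ℤ :=
  fun q => if P.pos q = Site.strand m i then sgn (μ.val m i) else 0

/-- The exponents of the base points on the loop of the right cusp `event m`, if it is one, for a
counterclockwise path: `+1` if the upper strand at the cusp is oriented to the right, `-1` if it is
oriented to the left. -/
def loopExp (m : Fin (D.M + 1)) : Fin s → ℤ :=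
  fun q => match P.pos q with
    | .strand _ _ => 0
    | .loop m' i _ _ => if m' = m then sgn (μ.val m' i) else 0

/-- The matrix `C` of slice `m` after the base points: the boundary of a disk runs to the left
along the upper strand `i` and to the right along the lower strand `j`. -/
noncomputable def basedC (m : Fin (D.M + 1)) :
    Matrix (Fin (D.N m)) (Fin (D.N m)) (D.Alg s) :=
  fun i j => mono (strandExp μ P m j - strandExp μ P m i) • D.matC s m i j

/-- The matrix `C̃` that arrives at the dip at slice `m + 1`. -/
noncomputable def tildeC (m : Fin (D.M + 1)) :
    Matrix (Fin (D.N (m + 1))) (Fin (D.N (m + 1))) (D.Alg s) :=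
  (D.event m).outgoing (D.aGen s m) (sgn ((D.event m).degree (μ.val m)))
    (algebraMap _ _ (mono (-loopExp μ P m))) (basedC μ P m)

/-- The diagonal matrix with entries `(-1)^{μ(i)}` at slice `m`. -/
noncomputable def matSigma (s : ℕ) (m : Fin (D.M + 1)) :
    Matrix (Fin (D.N m)) (Fin (D.N m)) (D.Alg s) :=
  Matrix.diagonal fun i => ((sgn (μ.val m i) : ℤ) : D.Alg s)

/-- The differential on the generators:
`∂C = (Σ C)²` and `∂B = -Σ (1 + B) Σ C + C̃ (1 + B)` in each dip. -/
noncomputable def diffGen : D.Gen → D.Alg s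
  | .a m _ => (D.event m).boundary (algebraMap _ _ (mono (loopExp μ P m))) (basedC μ P m)
  | .b m i j _ =>
      (-(matSigma μ s (m + 1) * (1 + D.matB s m) * matSigma μ s (m + 1) * D.matC s (m + 1)) +
        tildeC μ P m * (1 + D.matB s m)) i j
  | .c m i j _ => ((matSigma μ s m * D.matC s m) ^ 2) i j

/-- The differential of the DGA. -/
noncomputable def diff : D.Alg s → D.Alg s :=
  extend (fun g => sgn (degree μ g)) (diffGen μ P)

/-- An augmentation to `F` is a unital ring map that vanishes on the image of the differential. -/
def IsAugmentation {F : Type*} [Field F] (ε : D.Alg s →+* F) : Prop :=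
  ∀ x : D.Alg s, ε (diff μ P x) = 0

end DGA

end Front

end SolidTorus

/-! Only the values `A m` of the matrices `Σ C` matter. Since `Σ² = 1`, the equations of an
augmentation say: `A m` is strictly upper triangular of square zero; conjugated by the base points,
it passes `event m` with vanishing boundary and leaves as `A' m`; and the unitriangular `1 + B m`
conjugates `A' m` to `A (m + 1)`. Degrees impose no condition.

Suppose that every strand at every slice carries its own coefficient. A ruling then solves the
equations slab by slab, with the signed matrix of the involution (`rulingMatrix`) as `A m`, and with
generators `1` at switches and `0` elsewhere (`Event.exists_step_of_rulingStep`). At a switch,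
conjugating the transposition of the two strands by an elementary matrix gives, up to a sign, a
lower triangular elementary matrix. Normality provides an upper unitriangular factor that makes it
commute with the matrix of the involution (`exists_commute_of_normality`, `exists_conj_switch`).

The row and column of a self-paired strand vanish, so its coefficient does not enter the equations,
and the oriented product of all coefficients can be given any nonzero value. Diagonal conjugations
(`IsAugmentable.gauge`) slide coefficients along strands, around cusps and onto loops without
changing this product. As each component has a base point, all coefficients can be collected at the
given base points (`IsAugmentable.move`). -/

namespace SolidTorus

open Matrix

/-! ### Strands away from a crossing or cusp -/

section Skip

variable {n : ℕ} (k : Fin (n + 1))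

theorem skip_strictMono : StrictMono (skip k) :=
  (Fin.strictMono_succAbove _).comp (Fin.strictMono_succAbove _)

theorem skip_injective : Function.Injective (skip k) := (skip_strictMono k).injective

theorem skip_ne_succ (i : Fin n) : skip k i ≠ k.succ := Fin.succAbove_ne _ _

theorem skip_ne_castSucc (i : Fin n) : skip k i ≠ k.castSucc := by
  intro h
  rw [← Fin.succAbove_succ_self k] at h
  exact Fin.succAbove_ne _ _ (Fin.succAbove_right_injective h)

theorem eq_castSucc_or_eq_succ_or_eq_skip (i : Fin (n + 2)) :
    i = k.castSucc ∨ i = k.succ ∨ ∃ j, i = skip k j := by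
  rcases eq_or_ne i k.succ with h | h
  · exact Or.inr (Or.inl h)
  · obtain ⟨j, rfl⟩ := Fin.exists_succAbove_eq h
    rcases eq_or_ne j k with rfl | hj
    · exact Or.inl (Fin.succAbove_succ_self j)
    · obtain ⟨l, rfl⟩ := Fin.exists_succAbove_eq hj
      exact Or.inr (Or.inr ⟨l, rfl⟩)

theorem transp_apply_castSucc : transp k k.castSucc = k.succ := Equiv.swap_apply_left _ _

theorem transp_apply_succ : transp k k.succ = k.castSucc := Equiv.swap_apply_right _ _

theorem transp_apply_of_ne {i : Fin (n + 2)} (h₁ : i ≠ k.castSucc) (h₂ : i ≠ k.succ) :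
    transp k i = i := Equiv.swap_apply_of_ne_of_ne h₁ h₂

theorem transp_transp (i : Fin (n + 2)) : transp k (transp k i) = i := by
  simp [transp]

/-- The transposition of two neighbours preserves the order of all other pairs. -/
theorem transp_lt_transp {i j : Fin (n + 2)} (hij : i < j)
    (h : ¬ (i = k.castSucc ∧ j = k.succ)) : transp k i < transp k j := by
  by_cases i1 : i = k.castSucc <;> by_cases i2 : i = k.succ <;>
    by_cases j1 : j = k.castSucc <;> by_cases j2 : j = k.succ <;>
    simp_all [transp_apply_castSucc, transp_apply_succ, transp_apply_of_ne] <;>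
    simp_all [Fin.lt_def, Fin.ext_iff] <;> omega

end Skip

/-! ### Conjugation by diagonal matrices -/

section Conj

variable {F : Type*} [Field F] {n : ℕ}

/-- The conjugate of a matrix by the diagonal matrix with entries `t`. -/
def diagConj (t : Fin n → Fˣ) (A : Matrix (Fin n) (Fin n) F) : Matrix (Fin n) (Fin n) F :=
  fun i j => ((t i)⁻¹ : Fˣ) * A i j * t j

theorem diagConj_apply (t : Fin n → Fˣ) (A : Matrix (Fin n) (Fin n) F) (i j : Fin n) :
    diagConj t A i j = ((t i)⁻¹ : Fˣ) * A i j * t j := rfl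

theorem diagConj_mul (t : Fin n → Fˣ) (A B : Matrix (Fin n) (Fin n) F) :
    diagConj t (A * B) = diagConj t A * diagConj t B := by
  ext i j
  simp only [diagConj_apply, Matrix.mul_apply, Finset.mul_sum, Finset.sum_mul]
  refine Finset.sum_congr rfl fun l _ => ?_
  rw [show ((t i)⁻¹ : Fˣ) * A i l * t l * (((t l)⁻¹ : Fˣ) * B l j * t j)
    = ((t i)⁻¹ : Fˣ) * (A i l * B l j) * t j * ((t l : F) * ((t l)⁻¹ : Fˣ)) by ring]
  simp

theorem diagConj_add (t : Fin n → Fˣ) (A B : Matrix (Fin n) (Fin n) F) :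
    diagConj t (A + B) = diagConj t A + diagConj t B := by
  ext i j
  simp only [diagConj_apply, Matrix.add_apply]
  ring

theorem diagConj_zero (t : Fin n → Fˣ) :
    diagConj t (0 : Matrix (Fin n) (Fin n) F) = 0 := by
  ext i j
  simp [diagConj_apply]

theorem diagConj_one (t : Fin n → Fˣ) :
    diagConj t (1 : Matrix (Fin n) (Fin n) F) = 1 := by
  ext i j
  by_cases h : i = j
  · subst h; simp [diagConj_apply]
  · simp [diagConj_apply, h]

theorem one_diagConj (A : Matrix (Fin n) (Fin n) F) : diagConj 1 A = A := by
  ext i j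
  simp [diagConj_apply]

theorem diagConj_diagConj (t u : Fin n → Fˣ) (A : Matrix (Fin n) (Fin n) F) :
    diagConj t (diagConj u A) = diagConj (u * t) A := by
  ext i j
  simp only [diagConj_apply, Pi.mul_apply, mul_inv, Units.val_mul]
  ring

theorem diagConj_transvection (t : Fin n → Fˣ) (p q : Fin n) (c : F) :
    diagConj t (transvection p q c) = transvection p q (((t p)⁻¹ : Fˣ) * c * t q) := by
  rw [transvection, diagConj_add, diagConj_one, transvection]
  congr 1
  ext i j
  by_cases h : p = i ∧ q = j
  · obtain ⟨rfl, rfl⟩ := h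
    simp [diagConj_apply]
  · simp [diagConj_apply, h]

/-- A matrix whose entries on and below the diagonal vanish. -/
def StrictUpper {R : Type*} [Zero R] (A : Matrix (Fin n) (Fin n) R) : Prop :=
  ∀ i j, ¬ i < j → A i j = 0

theorem StrictUpper.diagConj {A : Matrix (Fin n) (Fin n) F} (hA : StrictUpper A)
    (t : Fin n → Fˣ) : StrictUpper (diagConj t A) := by
  intro i j h
  simp [diagConj_apply, hA i j h]

end Conj

/-! ### The matrix of an involution -/

section RulingMatrix

variable {F : Type*} [Field F] {n : ℕ}

/-- The strictly upper triangular matrix with the entry `s i` at `(i, σ i)` for each `i < σ i`. -/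
def rulingMatrix (σ : Fin n → Fin n) (s : Fin n → Fˣ) : Matrix (Fin n) (Fin n) F :=
  fun i j => if i < j ∧ σ i = j then (s i : F) else 0

theorem rulingMatrix_strictUpper (σ : Fin n → Fin n) (s : Fin n → Fˣ) :
    StrictUpper (rulingMatrix σ s) := by
  intro i j h
  simp [rulingMatrix, h]

/-- A nonzero term of the product would need `i < σ i < σ (σ i) = i`. -/
theorem rulingMatrix_mul_self {σ : Fin n → Fin n} (hσ : Function.Involutive σ)
    (s : Fin n → Fˣ) : rulingMatrix σ s * rulingMatrix σ s = 0 := by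
  ext i j
  rw [Matrix.mul_apply, Matrix.zero_apply]
  refine Finset.sum_eq_zero fun l _ => ?_
  unfold rulingMatrix
  split_ifs with h₁ h₂ <;> try simp
  obtain ⟨h₁, rfl⟩ := h₁
  rw [hσ] at h₂
  exact absurd (h₂.2 ▸ h₂.1) (not_lt.mpr h₁.le)

/-- Conjugation does not see the diagonal entries of self-paired strands. -/
theorem diagConj_rulingMatrix_congr (σ : Fin n → Fin n) (hσ : Function.Involutive σ)
    (s t u : Fin n → Fˣ)
    (h : ∀ i, σ i ≠ i → t i = u i) :
    diagConj t (rulingMatrix σ s) = diagConj u (rulingMatrix σ s) := by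
  ext i j
  simp only [diagConj_apply, rulingMatrix]
  split_ifs with hij
  · obtain ⟨hij, rfl⟩ := hij
    rw [h i hij.ne', h (σ i) (by rw [hσ]; exact hij.ne)]
  · simp

end RulingMatrix

/-! ### Switched crossings -/

section Switch

variable {F : Type*} [Field F] {n : ℕ}

theorem rulingMatrix_mul_single (σ : Fin n → Fin n) (hσ : Function.Involutive σ)
    (s : Fin n → Fˣ) (i j : Fin n) (c : F) :
    rulingMatrix σ s * single i j c =
      if σ i < i then single (σ i) j ((s (σ i) : F) * c) else 0 := by
  ext a b
  by_cases hb : b = j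
  · subst hb
    rw [Matrix.mul_single_apply_same]
    unfold rulingMatrix
    by_cases ha : σ i = a
    · subst ha
      by_cases h : σ i < i <;> simp [h, hσ i]
    · have : ¬ σ a = i := fun h => ha (by rw [← h, hσ])
      split_ifs <;> simp_all
  · rw [Matrix.mul_single_apply_of_ne _ _ _ _ _ hb]
    split_ifs <;> simp [Ne.symm hb]

theorem single_mul_rulingMatrix (σ : Fin n → Fin n)
    (s : Fin n → Fˣ) (i j : Fin n) (c : F) :
    single i j c * rulingMatrix σ s =
      if j < σ j then single i (σ j) (c * (s j : F)) else 0 := by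
  ext a b
  by_cases ha : a = i
  · subst ha
    rw [Matrix.single_mul_apply_same]
    unfold rulingMatrix
    by_cases hb : σ j = b
    · subst hb
      by_cases h : j < σ j <;> simp [h]
    · split_ifs <;> simp_all
  · rw [Matrix.single_mul_apply_of_ne _ _ _ _ _ ha]
    split_ifs <;> simp [Ne.symm ha]

/-- At a normal switch, a lower triangular elementary matrix can be corrected by an upper
triangular one so that the product commutes with the matrix of the involution. -/
theorem exists_commute_of_normality (k : Fin (n + 1)) {σ : Fin (n + 2) → Fin (n + 2)}
    (hσ : Function.Involutive σ) (s : Fin (n + 2) → Fˣ) (h : Normality k σ) :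
    ∃ Y : Matrix (Fin (n + 2)) (Fin (n + 2)) F, StrictUpper (Y - 1) ∧
      rulingMatrix σ s * ((1 - single k.succ k.castSucc 1) * Y) =
        ((1 - single k.succ k.castSucc 1) * Y) * rulingMatrix σ s := by
  have hpq : k.castSucc < k.succ := Fin.castSucc_lt_succ
  have hsu : ∀ c : F, σ k.succ < σ k.castSucc →
      StrictUpper ((1 - single (σ k.succ) (σ k.castSucc) c) - 1) := by
    intro c hc i j hij
    have : ¬ (σ k.succ = i ∧ σ k.castSucc = j) := by rintro ⟨rfl, rfl⟩; exact hij hc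
    simp [this]
  -- The five normality cases reduce to three: either `single k.succ k.castSucc 1` annihilates the
  -- ruling matrix from both sides, or the partners of the crossing strands are nested on one side,
  -- above or below.
  have key : (¬ σ k.succ < k.succ ∧ ¬ k.castSucc < σ k.castSucc) ∨
      (σ k.succ < σ k.castSucc ∧ σ k.castSucc < k.castSucc) ∨
      (k.succ < σ k.succ ∧ σ k.succ < σ k.castSucc) := by
    rcases h with h | h | h | h | h
    · exact Or.inr (Or.inl h)
    · exact Or.inl ⟨not_lt.mpr h.2.le, not_lt.mpr h.1.le⟩
    · exact Or.inr (Or.inr h)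
    · exact Or.inl ⟨not_lt.mpr h.2.le, by simp [h.1]⟩
    · exact Or.inl ⟨by simp [h.2], not_lt.mpr h.1.le⟩
  rcases key with ⟨h₁, h₂⟩ | ⟨h₁, h₂⟩ | ⟨h₁, h₂⟩
  · refine ⟨1, fun i j _ => by simp, ?_⟩
    rw [mul_one, mul_sub, sub_mul, rulingMatrix_mul_single σ hσ, single_mul_rulingMatrix]
    simp [h₁, h₂]
  -- Both partners lie above: the commutator leaves one term at `(σ k.succ, k.castSucc)`. The
  -- correction, multiplied by the ruling matrix on the right, yields the same matrix unit with
  -- factor `s (σ k.castSucc)`, which fixes the quotient.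
  · refine ⟨1 - single (σ k.succ) (σ k.castSucc)
      ((s (σ k.succ) : F) * ((s (σ k.castSucc))⁻¹ : Fˣ)), hsu _ h₁, ?_⟩
    have e : k.castSucc ≠ σ k.succ := (h₁.trans h₂).ne'
    have h₃ : σ k.succ < k.succ := h₁.trans (h₂.trans hpq)
    simp only [mul_sub, sub_mul, mul_one, one_mul, rulingMatrix_mul_single σ hσ,
      single_mul_rulingMatrix, Matrix.single_mul_single_of_ne _ _ _ _ e, hσ k.succ, hσ k.castSucc,
      if_pos h₃, if_neg h₂.not_gt, if_neg h₃.not_gt, if_pos h₂]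
    simp
  -- Both partners lie below: the leftover term sits at `(k.succ, σ k.castSucc)`, and now the ruling
  -- matrix acts on the correction from the left, with factor `s k.succ`.
  · refine ⟨1 - single (σ k.succ) (σ k.castSucc)
      ((s k.castSucc : F) * ((s k.succ)⁻¹ : Fˣ)), hsu _ h₂, ?_⟩
    have e : k.castSucc ≠ σ k.succ := (hpq.trans h₁).ne
    have h₃ : k.castSucc < σ k.castSucc := hpq.trans (h₁.trans h₂)
    simp only [mul_sub, sub_mul, mul_one, one_mul, rulingMatrix_mul_single σ hσ,
      single_mul_rulingMatrix, Matrix.single_mul_single_of_ne _ _ _ _ e, hσ k.succ, hσ k.castSucc,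
      if_pos h₁, if_neg h₁.not_gt, if_neg h₃.not_gt, if_pos h₃]
    simp [mul_left_comm]

/-- The permutation matrix of the transposition `(k  k+1)`. -/
def transpMatrix (F : Type*) [Field F] (k : Fin (n + 1)) : Matrix (Fin (n + 2)) (Fin (n + 2)) F :=
  (1 : Matrix _ _ F).submatrix (transp k) id

/-- The permutation matrix is its own inverse, so renumbering the strands is a conjugation and a
switch becomes a computation with matrix products. -/
theorem submatrix_transp (k : Fin (n + 1)) (A : Matrix (Fin (n + 2)) (Fin (n + 2)) F) :
    A.submatrix (transp k) (transp k) = transpMatrix F k * A * transpMatrix F k := by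
  have h₁ : transpMatrix F k * A = A.submatrix (transp k) id := by
    ext i j
    simp [transpMatrix, Matrix.mul_apply, Matrix.one_apply]
  rw [h₁]
  ext i j
  have h₂ : ∀ l, transpMatrix F k l j = if l = transp k j then 1 else 0 := fun l => by
    simp only [transpMatrix, Matrix.submatrix_apply, id, Matrix.one_apply]
    congr 1
    exact propext ⟨fun h => by rw [← h, transp_transp], fun h => by rw [h, transp_transp]⟩
  simp [Matrix.mul_apply, h₂]

theorem transpMatrix_eq (k : Fin (n + 1)) :
    transpMatrix F k = 1 - single k.castSucc k.castSucc 1 - single k.succ k.succ 1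
      + single k.castSucc k.succ 1 + single k.succ k.castSucc 1 := by
  have hpq : k.castSucc ≠ k.succ := Fin.castSucc_lt_succ.ne
  ext i j
  rcases eq_or_ne i k.castSucc with rfl | h₁
  · simp [transpMatrix, transp_apply_castSucc, Matrix.single_apply, Matrix.one_apply, hpq.symm]
  · rcases eq_or_ne i k.succ with rfl | h₂
    · simp [transpMatrix, transp_apply_succ, Matrix.single_apply, Matrix.one_apply, hpq]
    · simp [transpMatrix, Matrix.one_apply, transp_apply_of_ne k h₁ h₂, h₁.symm, h₂.symm]

theorem transpMatrix_mul_self (k : Fin (n + 1)) : transpMatrix F k * transpMatrix F k = 1 := by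
  have := submatrix_transp (F := F) k 1
  rw [mul_one] at this
  rw [← this]
  ext i j
  simp [Matrix.one_apply]

/-- The sign change of the strand `k + 1`. -/
def flip (F : Type*) [Field F] (k : Fin (n + 1)) : Fin (n + 2) → Fˣ :=
  fun i => if i = k.succ then -1 else 1

theorem diagonal_flip (k : Fin (n + 1)) :
    diagonal (fun i => (flip F k i : F)) = 1 - single k.succ k.succ 1 - single k.succ k.succ 1 := by
  ext i j
  by_cases hij : i = j
  · subst hij
    by_cases h : i = k.succ
    · subst h; simp [flip]
    · simp [flip, h, Ne.symm h]
  · have : ¬ (k.succ = i ∧ k.succ = j) := by rintro ⟨rfl, rfl⟩; exact hij rfl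
    simp [hij, this]

theorem diagConj_flip (k : Fin (n + 1)) (A : Matrix (Fin (n + 2)) (Fin (n + 2)) F) :
    diagConj (flip F k) A =
      diagonal (fun i => (flip F k i : F)) * A * diagonal (fun i => (flip F k i : F)) := by
  ext i j
  rw [Matrix.mul_diagonal, Matrix.diagonal_mul, diagConj_apply]
  congr 2
  unfold flip
  split_ifs <;> simp

/-- In the block of the two strands both sides are `[[1, 0], [1, -1]]`. This trades the permutation
at a crossing for a lower triangular matrix, which explains the generator value `1` and the sign
flip at a switch. -/
theorem transvection_mul_transpMatrix_mul_transvection (k : Fin (n + 1)) :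
    transvection k.castSucc k.succ 1 * transpMatrix F k * transvection k.castSucc k.succ (-1) =
      diagonal (fun i => (flip F k i : F)) * (1 - single k.succ k.castSucc 1) := by
  have hpq : k.castSucc ≠ k.succ := Fin.castSucc_lt_succ.ne
  rw [transpMatrix_eq, diagonal_flip]
  simp only [transvection, show single k.castSucc k.succ (-1 : F) =
    -single k.castSucc k.succ 1 from (Matrix.single_neg _ _ _).symm, ← sub_eq_add_neg]
  simp only [mul_add, add_mul, mul_sub, sub_mul, mul_one, one_mul, Matrix.single_mul_single_same,
    Matrix.single_mul_single_of_ne _ _ _ _ hpq.symm]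
  abel

/-- The outgoing matrix of a switched crossing with generator `1` is conjugate to the matrix of the
involution by an upper unitriangular matrix. -/
theorem exists_conj_switch (k : Fin (n + 1)) {σ : Fin (n + 2) → Fin (n + 2)}
    (hσ : Function.Involutive σ) (s : Fin (n + 2) → Fˣ) (h : Normality k σ) :
    ∃ B : Matrix (Fin (n + 2)) (Fin (n + 2)) F, StrictUpper B ∧
      (transvection k.castSucc k.succ (-1) * diagConj (flip F k) (rulingMatrix σ s) *
        transvection k.castSucc k.succ 1).submatrix (transp k) (transp k) * (1 + B) =
        (1 + B) * rulingMatrix σ s := by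
  obtain ⟨Y, hY, hc⟩ := exists_commute_of_normality k hσ s h
  have hpq : k.castSucc ≠ k.succ := Fin.castSucc_lt_succ.ne
  have key := transvection_mul_transpMatrix_mul_transvection (F := F) k
  -- Here `1 + B` is `E' * Y` in the notation of the calculation below. Left multiplication by `E'`
  -- only subtracts row `k + 1` of `Y` from row `k`, so it keeps `Y` upper unitriangular.
  refine ⟨transvection k.castSucc k.succ (-1) * Y - 1, ?_, ?_⟩
  · intro i j hij
    have hs : ∀ l, ¬ l ≤ j → Y l j = 0 := fun l hl => by
      have := hY l j (fun h => hl h.le)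
      rwa [Matrix.sub_apply, Matrix.one_apply_ne (fun h => hl h.le), sub_zero] at this
    have hy := hY i j hij
    rw [transvection, add_mul, one_mul, Matrix.sub_apply, Matrix.add_apply]
    rw [Matrix.sub_apply] at hy
    by_cases hi : i = k.castSucc
    · subst hi
      rw [Matrix.single_mul_apply_same, hs k.succ
        (fun h => hij (Fin.castSucc_lt_succ.trans_le h))]
      linear_combination hy
    · rw [Matrix.single_mul_apply_of_ne _ _ _ _ _ hi]
      linear_combination hy
  · rw [add_sub_cancel, submatrix_transp, diagConj_flip]
    set E := transvection k.castSucc k.succ (1 : F)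
    set E' := transvection k.castSucc k.succ (-1 : F)
    set P := transpMatrix F k
    set d := diagonal (fun i => (flip F k i : F))
    set W := rulingMatrix σ s
    set Z := (1 : Matrix _ _ F) - single k.succ k.castSucc 1
    have hE : E' * E = 1 := by
      rw [Matrix.transvection_mul_transvection_same _ _ hpq]; simp
    have hd : d * d = 1 := by
      rw [Matrix.diagonal_mul_diagonal, ← Matrix.diagonal_one]
      congr 1; ext i; unfold flip; split_ifs <;> simp
    have hP : P * P = 1 := transpMatrix_mul_self k
    calc P * (E' * (d * W * d) * E) * P * (E' * Y)
        = P * E' * d * W * d * (E * P * E') * Y := by noncomm_ring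
      _ = P * E' * d * W * (d * d) * Z * Y := by rw [key]; noncomm_ring
      _ = P * E' * d * (W * (Z * Y)) := by rw [hd]; noncomm_ring
      _ = P * E' * (d * Z) * Y * W := by rw [hc]; noncomm_ring
      _ = P * (E' * E) * P * E' * Y * W := by rw [← key]; noncomm_ring
      _ = E' * Y * W := by rw [hE, mul_one, hP, one_mul]

end Switch

/-! ### Signs -/

theorem sgn_eq_or {r : ℕ} (d : ZMod (2 * r)) : sgn d = 1 ∨ sgn d = -1 := by
  unfold sgn; split_ifs <;> simp

theorem sgn_mul_self {r : ℕ} (d : ZMod (2 * r)) : sgn d * sgn d = 1 := by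
  rcases sgn_eq_or d with h | h <;> simp [h]

theorem sgn_sub {r : ℕ} (d e : ZMod (2 * r)) : sgn (d - e) = sgn d * sgn e := by
  unfold sgn
  rw [map_sub]
  generalize ZMod.castHom (Dvd.intro r rfl) (ZMod 2) d = x
  generalize ZMod.castHom (Dvd.intro r rfl) (ZMod 2) e = y
  revert x y
  decide

theorem sgn_add_one {r : ℕ} (d : ZMod (2 * r)) : sgn (d + 1) = -sgn d := by
  unfold sgn
  rw [map_add, map_one]
  generalize ZMod.castHom (Dvd.intro r rfl) (ZMod 2) d = x
  revert x
  decide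

/-- The sign of a degree as a unit of `F`. -/
def sgnUnit (F : Type*) [Field F] {r : ℕ} (d : ZMod (2 * r)) : Fˣ :=
  (-1) ^ (if sgn d = 1 then 0 else 1)

theorem coe_sgnUnit (F : Type*) [Field F] {r : ℕ} (d : ZMod (2 * r)) :
    (sgnUnit F d : F) = (sgn d : F) := by
  rcases sgn_eq_or d with h | h <;> simp [h, sgnUnit]

/-! ### Passing an event -/

namespace Event

variable {F : Type*} [Field F]

/-- The matrix `A` to the left of an event has vanishing boundary, and leaves the event as `A'`.
Here `A` and `A'` are the matrices `Σ C` and `Σ C̃`, and only the value `0` is considered for the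
generator of a right cusp. -/
def Step (a τ : F) : {n n' : ℕ} → Event n n' → (Fin n → Fˣ) → (Fin n' → Fˣ) →
    Matrix (Fin n) (Fin n) F → Matrix (Fin n') (Fin n') F → Prop
  | _, _, .trivial _, _, _, A, A' => A' = A
  -- Passing from `C` to `Σ C` absorbs the sign of `a` in `U`; up to the transposition, `U` and `V`
  -- become mutually inverse transvections.
  | _, _, .crossing _ k, _, _, A, A' => A k.castSucc k.succ = 0 ∧
      A' = (transvection k.castSucc k.succ (-a) * A *
        transvection k.castSucc k.succ a).submatrix (transp k) (transp k)
  | _, _, .leftCusp _ k, _, s', A, A' =>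
      (∀ i j, A' (skip k i) (skip k j) = A i j) ∧ A' k.castSucc k.succ = s' k.castSucc ∧
      (∀ j, j ≠ k.succ → A' k.castSucc j = 0) ∧ (∀ j, A' k.succ j = 0) ∧
      (∀ i, A' i k.castSucc = 0) ∧ (∀ i, i ≠ k.castSucc → A' i k.succ = 0)
  -- With `a = 0` and column `k + 1` zero on the other strands, the left factor of the loop term
  -- vanishes, leaving a plain submatrix.
  | _, _, .rightCusp _ k, s, _, A, A' => a = 0 ∧
      A k.castSucc k.succ = -(s k.castSucc * τ) ∧ (∀ i, A (skip k i) k.succ = 0) ∧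
      A' = A.submatrix (skip k) (skip k)

/-- Conjugation by diagonal matrices that agree along the strands through the event. -/
theorem Step.diagConj {n n' : ℕ} {e : Event n n'} {a τ : F} {s : Fin n → Fˣ} {s' : Fin n' → Fˣ}
    {A : Matrix (Fin n) (Fin n) F} {A' : Matrix (Fin n') (Fin n') F}
    (hA : e.Step a τ s s' A A') (h : Fin n → Fˣ) (g : Fin n' → Fˣ) (κ : Fˣ)
    (hthrough : ∀ i j, e.Through i j → h i = g j)
    (hleft : ∀ i j, e.LeftCuspAt i j → g i = g j)
    (hright : ∀ i j, e.RightCuspAt i j → h j = κ * h i) :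
    ∃ a', e.Step a' (τ * κ) s s' (SolidTorus.diagConj h A) (SolidTorus.diagConj g A') := by
  cases e with
  | trivial n =>
    refine ⟨a, ?_⟩
    have : h = g := funext fun i => hthrough i i rfl
    subst this
    exact congrArg _ hA
  | crossing n k =>
    obtain ⟨h₀, rfl⟩ := hA
    -- Diagonal conjugation of a transvection rescales its parameter, so the generator absorbs the
    -- change.
    refine ⟨((h k.castSucc)⁻¹ : Fˣ) * a * h k.succ, by simp [diagConj_apply, h₀], ?_⟩
    have hg : ∀ i, g i = h (transp k i) := fun i =>
      (hthrough _ _ (transp_transp k i).symm).symm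
    have e₁ : -(((h k.castSucc)⁻¹ : Fˣ) * a * h k.succ : F) =
      ((h k.castSucc)⁻¹ : Fˣ) * (-a) * h k.succ := by ring
    rw [e₁, ← diagConj_transvection, ← diagConj_transvection, ← diagConj_mul, ← diagConj_mul]
    ext i j
    simp only [diagConj_apply, Matrix.submatrix_apply, hg]
  | leftCusp n k =>
    obtain ⟨h₁, h₂, h₃, h₄, h₅, h₆⟩ := hA
    have hs : ∀ i, g (skip k i) = h i := fun i => (hthrough i _ rfl).symm
    have hl : g k.castSucc = g k.succ := hleft _ _ ⟨rfl, rfl⟩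
    refine ⟨a, fun i j => ?_, ?_, fun j hj => ?_, fun j => ?_, fun i => ?_, fun i hi => ?_⟩
    · simp [diagConj_apply, hs, h₁]
    · rw [diagConj_apply, h₂, hl, mul_right_comm]; simp
    · simp [diagConj_apply, h₃ j hj]
    · simp [diagConj_apply, h₄ j]
    · simp [diagConj_apply, h₅ i]
    · simp [diagConj_apply, h₆ i hi]
  | rightCusp n k =>
    obtain ⟨h₀, h₁, h₂, rfl⟩ := hA
    have hs : ∀ i, h (skip k i) = g i := fun i => hthrough _ i rfl
    have hr := hright k.castSucc k.succ ⟨rfl, rfl⟩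
    refine ⟨a, h₀, ?_, fun i => ?_, ?_⟩
    · rw [diagConj_apply, h₁, hr, Units.val_mul]
      have : (((h k.castSucc)⁻¹ : Fˣ) : F) * h k.castSucc = 1 := by simp
      linear_combination (-(s k.castSucc * τ * κ : F)) * this
    · simp [diagConj_apply, h₂ i]
    · ext i j
      simp [diagConj_apply, hs]

/-- A step of a ruling gives a step of the matrices of its involutions, after a conjugation by a
diagonal matrix on the left and an upper unitriangular matrix on the right. -/
theorem exists_step_of_rulingStep {n n' : ℕ} {e : Event n n'} {σ : Fin n → Fin n}
    {σ' : Fin n' → Fin n'} (hσ : Function.Involutive σ) (hσ' : Function.Involutive σ')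
    (h : e.RulingStep σ σ') (s : Fin n → Fˣ) (s' : Fin n' → Fˣ)
    (hs : ∀ i j, e.Through i j → s' j = s i) :
    ∃ (t : Fin n → Fˣ) (a : F) (A' B : Matrix (Fin n') (Fin n') F), StrictUpper B ∧
      e.Step a 1 s s' (SolidTorus.diagConj t (rulingMatrix σ s)) A' ∧
      A' * (1 + B) = (1 + B) * rulingMatrix σ' s' := by
  have hz : ∀ n : ℕ, StrictUpper (0 : Matrix (Fin n) (Fin n) F) := fun _ _ _ _ => rfl
  cases e with
  | trivial n =>
    have : s' = s := funext fun i => hs i i rfl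
    subst this
    obtain rfl : σ' = σ := h
    exact ⟨1, 0, _, 0, hz _, one_diagConj _ |>.symm, by simp⟩
  | crossing n k =>
    have hst : ∀ i, s' i = s (transp k i) := fun i => hs _ _ (transp_transp k i).symm
    obtain ⟨hpq, rfl | ⟨rfl, hN⟩⟩ := h
    -- Without a switch the generator is `0`. Since `k` and `k + 1` are not paired, the
    -- transposition reverses no pair, and upper entries stay upper.
    · refine ⟨1, 0, _, 0, hz _, ⟨?_, rfl⟩, ?_⟩
      · simp [one_diagConj, rulingMatrix, hpq]
      · simp only [neg_zero, transvection_zero, one_mul, mul_one, add_zero, one_diagConj]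
        ext i j
        simp only [rulingMatrix, Matrix.submatrix_apply, Function.comp_apply, hst]
        have : (transp k i < transp k j ∧ σ (transp k i) = transp k j) ↔
            (i < j ∧ transp k (σ (transp k i)) = j) := by
          constructor
          · rintro ⟨h₁, h₂⟩
            refine ⟨?_, by rw [h₂, transp_transp]⟩
            have := transp_lt_transp k h₁ (by rintro ⟨h₃, h₄⟩; rw [h₃, h₄] at h₂; exact hpq h₂)
            rwa [transp_transp, transp_transp] at this
          · rintro ⟨h₁, h₂⟩
            refine ⟨transp_lt_transp k h₁ ?_, by rw [← h₂, transp_transp]⟩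
            rintro ⟨rfl, rfl⟩
            have h₃ : σ k.succ = k.castSucc := by
              rw [← transp_apply_castSucc, ← transp_transp k (σ _), h₂, transp_apply_succ]
            exact hpq (by rw [← h₃, hσ])
        simp only [this]
    · obtain ⟨B, hB, hc⟩ := exists_conj_switch (F := F) k hσ s' hN
      -- The ruling need not be graded: at a switch the signs `s` and `s' = s ∘ transp k` may differ
      -- although the involution stays the same. Rescaling the upper strand of each pair replaces
      -- `s` by `s'`; `flip` is the sign needed by `exists_conj_switch`.
      have e : SolidTorus.diagConj
          (fun i => (if i < σ' i then s i * (s' i)⁻¹ else 1) * flip F k i) (rulingMatrix σ' s) =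
          SolidTorus.diagConj (flip F k) (rulingMatrix σ' s') := by
        ext i j
        simp only [diagConj_apply, rulingMatrix]
        by_cases hij : i < j ∧ σ' i = j
        · obtain ⟨hij, rfl⟩ := hij
          have : ¬ σ' i < σ' (σ' i) := by rw [hσ]; exact hij.not_gt
          simp only [hij, this, if_true, if_false, one_mul, mul_inv, inv_inv, Units.val_mul,
            and_self]
          have hu : (((s i)⁻¹ : Fˣ) : F) * s i = 1 := by simp
          linear_combination
            (s' i * ((flip F k i)⁻¹ : Fˣ) * flip F k (σ' i) : F) * hu
        · simp [hij]
      refine ⟨_, 1, _, B, hB, ⟨?_, rfl⟩, e ▸ hc⟩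
      simp [diagConj_apply, rulingMatrix, hpq]
  | leftCusp n k =>
    obtain ⟨h₁, h₂⟩ := h
    have hlt : k.castSucc < k.succ := Fin.castSucc_lt_succ
    have h₁' : σ' k.succ = k.castSucc := by rw [← h₁, hσ']
    have hss : ∀ i, s' (skip k i) = s i := fun i => hs i _ rfl
    refine ⟨1, 0, rulingMatrix σ' s', 0, hz _, ⟨fun i j => ?_, ?_, fun j hj => ?_, fun j => ?_,
      fun i => ?_, fun i hi => ?_⟩, by simp⟩
    · simp [one_diagConj, rulingMatrix, h₂, hss, (skip_injective k).eq_iff,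
        (skip_strictMono k).lt_iff_lt]
    · simp [rulingMatrix, h₁]
    · simp [rulingMatrix, h₁, hj.symm]
    · have : ¬ (k.succ < j ∧ σ' k.succ = j) := by
        rw [h₁']; rintro ⟨h, rfl⟩; exact h.not_gt hlt
      simp [rulingMatrix, this]
    · have : ¬ (i < k.castSucc ∧ σ' i = k.castSucc) := by
        rintro ⟨h, h'⟩
        rw [← h₁', hσ'.injective.eq_iff] at h'
        subst h'; exact h.not_gt hlt
      simp [rulingMatrix, this]
    · have : ¬ σ' i = k.succ := by rwa [← h₁, hσ'.injective.eq_iff]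
      simp [rulingMatrix, this]
  | rightCusp n k =>
    obtain ⟨h₁, h₂⟩ := h
    have hss : ∀ i, s' i = s (skip k i) := fun i => hs _ i rfl
    -- The sign on the upper strand turns the entry of the cusp pair into `-s`, which cancels the
    -- loop monomial, here `1`.
    refine ⟨fun i => if i = k.castSucc then -1 else 1, 0, _, 0, hz _,
      ⟨rfl, ?_, fun i => ?_, rfl⟩, ?_⟩
    · simp [diagConj_apply, rulingMatrix, h₁, Fin.castSucc_lt_succ.ne']
    · simp [diagConj_apply, rulingMatrix, h₂, skip_ne_succ]
    · rw [add_zero, mul_one, one_mul]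
      ext i j
      simp [diagConj_apply, rulingMatrix, h₂, hss, (skip_injective k).eq_iff,
        (skip_strictMono k).lt_iff_lt, skip_ne_castSucc]

end Event

/-! ### The strands at an event -/

namespace Event

variable {n n' : ℕ} {e : Event n n'}

/-- This and the following incidence facts show that a gauge supported on one or two strand ends
satisfies the matching conditions at all other ends. -/
theorem Through.right_unique {i : Fin n} {j j' : Fin n'} (h : e.Through i j)
    (h' : e.Through i j') : j = j' := by
  cases e with
  | rightCusp n k => exact skip_injective k (h.symm.trans h')
  | _ => exact Eq.trans h (Eq.symm h')

theorem Through.left_unique {i i' : Fin n} {j : Fin n'} (h : e.Through i j)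
    (h' : e.Through i' j) : i = i' := by
  cases e with
  | trivial n => exact Eq.trans (Eq.symm h) h'
  | crossing n k => exact (transp k).injective (Eq.trans (Eq.symm h) h')
  | leftCusp n k => exact skip_injective k (Eq.trans (Eq.symm h) h')
  | rightCusp n k => exact Eq.trans h (Eq.symm h')

theorem Through.ne_of_leftCuspAt {i : Fin n} {j k l : Fin n'} (h : e.Through i j)
    (h' : e.LeftCuspAt k l) : k ≠ j ∧ l ≠ j := by
  cases e with
  | leftCusp n c =>
    obtain ⟨rfl, rfl⟩ := h'
    obtain rfl : j = skip c i := h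
    exact ⟨(skip_ne_castSucc c i).symm, (skip_ne_succ c i).symm⟩
  | _ => exact h'.elim

theorem Through.ne_of_rightCuspAt {i k l : Fin n} {j : Fin n'} (h : e.Through i j)
    (h' : e.RightCuspAt k l) : k ≠ i ∧ l ≠ i := by
  cases e with
  | rightCusp n c =>
    obtain ⟨rfl, rfl⟩ := h'
    obtain rfl : i = skip c j := h
    exact ⟨(skip_ne_castSucc c j).symm, (skip_ne_succ c j).symm⟩
  | _ => exact h'.elim

theorem LeftCuspAt.unique {i j i' j' : Fin n'} (h : e.LeftCuspAt i j)
    (h' : e.LeftCuspAt i' j') : i = i' ∧ j = j' := by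
  cases e with
  | leftCusp n k => exact ⟨h.1.trans h'.1.symm, h.2.trans h'.2.symm⟩
  | _ => exact h'.elim

theorem RightCuspAt.unique {i j i' j' : Fin n} (h : e.RightCuspAt i j)
    (h' : e.RightCuspAt i' j') : i = i' ∧ j = j' := by
  cases e with
  | rightCusp n k => exact ⟨h.1.trans h'.1.symm, h.2.trans h'.2.symm⟩
  | _ => exact h'.elim

theorem LeftCuspAt.ne {i j : Fin n'} (h : e.LeftCuspAt i j) : i ≠ j := by
  cases e with
  | leftCusp n k => rw [h.1, h.2]; exact Fin.castSucc_lt_succ.ne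
  | _ => exact h.elim

theorem RightCuspAt.ne {i j : Fin n} (h : e.RightCuspAt i j) : i ≠ j := by
  cases e with
  | rightCusp n k => rw [h.1, h.2]; exact Fin.castSucc_lt_succ.ne
  | _ => exact h.elim

end Event

/-! ### Augmentations with a coefficient on every strand -/

namespace Front

variable {D : Front} {r : ℕ} {F : Type*} [Field F]

/-- A coefficient for each strand and for the loop of each right cusp. -/
abbrev Coeffs (D : Front) (F : Type*) [Field F] : Type _ :=
  (D.Strand → Fˣ) × (Fin (D.M + 1) → Fˣ)

/-- The equations of an augmentation have a solution, where the products of the base points on the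
strands and loops take the values `x`. The matrices `A m` are the values of `Σ C`. -/
def IsAugmentable (μ : D.MaslovPotential r) (x : D.Coeffs F) : Prop :=
  ∃ (a : Fin (D.M + 1) → F) (A : ∀ m, Matrix (Fin (D.N m)) (Fin (D.N m)) F)
    (A' B : ∀ m, Matrix (Fin (D.N (m + 1))) (Fin (D.N (m + 1))) F), ∀ m,
    StrictUpper (A m) ∧ A m * A m = 0 ∧ StrictUpper (B m) ∧
    (D.event m).Step (a m) (x.2 m) (fun i => sgnUnit F (μ.val m i))
      (fun i => sgnUnit F (μ.val (m + 1) i)) (diagConj (fun i => x.1 ⟨m, i⟩) (A m)) (A' m) ∧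
    A' m * (1 + B m) = (1 + B m) * A (m + 1)

/-- Gauge transformations of the coefficients. -/
theorem IsAugmentable.gauge {μ : D.MaslovPotential r} {x : D.Coeffs F} (hx : IsAugmentable μ x)
    (g h : D.Strand → Fˣ) (κ : Fin (D.M + 1) → Fˣ)
    (hthrough : ∀ m i j, (D.event m).Through i j → h ⟨m, i⟩ = g ⟨m + 1, j⟩)
    (hleft : ∀ m i j, (D.event m).LeftCuspAt i j → g ⟨m + 1, i⟩ = g ⟨m + 1, j⟩)
    (hright : ∀ m i j, (D.event m).RightCuspAt i j → h ⟨m, j⟩ = κ m * h ⟨m, i⟩) :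
    IsAugmentable μ ((h / g, κ) * x) := by
  obtain ⟨a, A, A', B, hA⟩ := hx
  have key := fun m => (hA m).2.2.2.1.diagConj (fun i => h ⟨m, i⟩) (fun i => g ⟨m + 1, i⟩) (κ m)
    (hthrough m) (hleft m) (hright m)
  choose a' ha' using key
  -- At each slice `g` acts before the base points and `h` after them; the new coefficient `h / g *
  -- x` makes up the difference, since `g * (h / g * x) = x * h`.
  refine ⟨a', fun m => diagConj (fun i => g ⟨m, i⟩) (A m),
    fun m => diagConj (fun i => g ⟨m + 1, i⟩) (A' m),
    fun m => diagConj (fun i => g ⟨m + 1, i⟩) (B m), fun m => ?_⟩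
  obtain ⟨h₁, h₂, h₃, -, h₅⟩ := hA m
  refine ⟨h₁.diagConj _, by rw [← diagConj_mul, h₂, diagConj_zero], h₃.diagConj _, ?_, ?_⟩
  · convert ha' m using 1
    · simp [mul_comm]
    · rw [diagConj_diagConj, diagConj_diagConj]
      congr 1
      ext i
      simp [div_mul_eq_mul_div, mul_comm]
  · rw [← diagConj_one (fun i => g ⟨m + 1, i⟩), ← diagConj_add, ← diagConj_mul, ← diagConj_mul, h₅]

/-- The coefficients of a base point at the site `x` with value `v`. -/
def siteCoeffs (μ : D.MaslovPotential r) : D.Site → Fˣ → D.Coeffs F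
  | .strand m i, v => (Pi.mulSingle ⟨m, i⟩ (v ^ sgn (μ.val m i)), 1)
  | .loop m i _ _, v => (1, Pi.mulSingle m (v ^ sgn (μ.val m i)))

theorem siteCoeffs_one (μ : D.MaslovPotential r) (x : D.Site) :
    siteCoeffs μ x (1 : Fˣ) = 1 := by
  cases x <;> simp [siteCoeffs]

theorem siteCoeffs_mul (μ : D.MaslovPotential r) (x : D.Site) (v w : Fˣ) :
    siteCoeffs μ x (v * w) = siteCoeffs μ x v * siteCoeffs μ x w := by
  cases x <;> simp [siteCoeffs, mul_zpow, Pi.mulSingle_mul]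

/-- A base point can be moved from the site `x` to the site `y`. -/
def Movable (F : Type*) [Field F] (μ : D.MaslovPotential r) (x y : D.Site) : Prop :=
  ∀ (v : Fˣ) (g : D.Coeffs F), IsAugmentable μ (siteCoeffs μ x v * g) →
    IsAugmentable μ (siteCoeffs μ y v * g)

theorem Movable.symm {μ : D.MaslovPotential r} {x y : D.Site} (h : Movable F μ x y) :
    Movable F μ y x := by
  intro v g hg
  have hinv : ∀ z, siteCoeffs μ z v⁻¹ * siteCoeffs μ z v = 1 := fun z => by
    rw [← siteCoeffs_mul, inv_mul_cancel, siteCoeffs_one]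
  -- Create a cancelling pair `v⁻¹`, `v` at `x` and move `v⁻¹` to `y`, where it cancels the `v`
  -- already there.
  have := h v⁻¹ (siteCoeffs μ x v * siteCoeffs μ y v * g) (by
    rwa [← mul_assoc, ← mul_assoc, hinv, one_mul])
  rwa [mul_comm (siteCoeffs μ x v), ← mul_assoc, ← mul_assoc, hinv, one_mul] at this

theorem Movable.trans {μ : D.MaslovPotential r} {x y z : D.Site} (h : Movable F μ x y)
    (h' : Movable F μ y z) : Movable F μ x z :=
  fun v g hg => h' v g (h v g hg)

theorem Movable.of_gauge {μ : D.MaslovPotential r} {x y : D.Site}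
    (H : ∀ v : Fˣ, ∃ (g h : D.Strand → Fˣ) (κ : Fin (D.M + 1) → Fˣ),
      (∀ m i j, (D.event m).Through i j → h ⟨m, i⟩ = g ⟨m + 1, j⟩) ∧
      (∀ m i j, (D.event m).LeftCuspAt i j → g ⟨m + 1, i⟩ = g ⟨m + 1, j⟩) ∧
      (∀ m i j, (D.event m).RightCuspAt i j → h ⟨m, j⟩ = κ m * h ⟨m, i⟩) ∧
      siteCoeffs μ y v = (h / g, κ) * siteCoeffs μ x v) : Movable F μ x y := by
  intro v z hz
  obtain ⟨g, h, κ, h₁, h₂, h₃, h₄⟩ := H v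
  rw [h₄, mul_assoc]
  exact hz.gauge g h κ h₁ h₂ h₃

theorem mulSingle_strand_apply (m : Fin (D.M + 1)) (i j : Fin (D.N m)) (c : Fˣ) :
    (Pi.mulSingle (⟨m, i⟩ : D.Strand) c : D.Strand → Fˣ) ⟨m, j⟩ = if j = i then c else 1 := by
  simp [Pi.mulSingle_apply]

theorem mulSingle_strand_apply_of_ne {m m' : Fin (D.M + 1)} (hm : m' ≠ m) (i : Fin (D.N m))
    (j : Fin (D.N m')) (c : Fˣ) :
    (Pi.mulSingle (⟨m, i⟩ : D.Strand) c : D.Strand → Fˣ) ⟨m', j⟩ = 1 :=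
  Pi.mulSingle_eq_of_ne (fun h => hm (congrArg Sigma.fst h)) _

/-- The gauge is supported on the strand ends joined by the adjacency: `h` on the left and `g` on
the right of a slab, both strands of a cusp on one side. At a cusp the potentials differ by `1`, so
the opposite orientations account for the inverted coefficient. As `g` and `h` are independent
functions, a front with a single slice, where `m + 1 = m`, needs no special care. -/
theorem movable_of_adj (μ : D.MaslovPotential r) {p q : D.Strand} (h : D.Adj p q) :
    Movable F μ (.strand p.1 p.2) (.strand q.1 q.2) := by
  refine Movable.of_gauge fun v => ?_
  have hne : ∀ {m m' : Fin (D.M + 1)}, m' ≠ m → m' + 1 ≠ m + 1 := fun h h' =>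
    h (add_right_cancel h')
  cases h with
  | through m i j hij =>
    have hμ := μ.through m i j hij
    refine ⟨Pi.mulSingle ⟨m + 1, j⟩ (v ^ sgn (μ.val m i))⁻¹,
      Pi.mulSingle ⟨m, i⟩ (v ^ sgn (μ.val m i))⁻¹, 1, fun m' i' j' h' => ?_, fun m' i' j' h' => ?_,
      fun m' i' j' h' => ?_, ?_⟩
    · by_cases hm : m' = m
      · subst hm
        have : i' = i ↔ j' = j := ⟨by rintro rfl; exact h'.right_unique hij,
          by rintro rfl; exact h'.left_unique hij⟩
        rw [mulSingle_strand_apply, mulSingle_strand_apply]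
        simp only [this]
      · rw [mulSingle_strand_apply_of_ne hm, mulSingle_strand_apply_of_ne (hne hm)]
    · by_cases hm : m' = m
      · subst hm
        have := hij.ne_of_leftCuspAt h'
        rw [mulSingle_strand_apply, mulSingle_strand_apply, if_neg this.1, if_neg this.2]
      · rw [mulSingle_strand_apply_of_ne (hne hm), mulSingle_strand_apply_of_ne (hne hm)]
    · by_cases hm : m' = m
      · subst hm
        have := hij.ne_of_rightCuspAt h'
        rw [mulSingle_strand_apply, mulSingle_strand_apply, if_neg this.1, if_neg this.2]
        simp
      · rw [mulSingle_strand_apply_of_ne hm, mulSingle_strand_apply_of_ne hm]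
        simp
    · simp only [siteCoeffs, hμ, Pi.mulSingle_inv, Prod.mk_mul_mk, mul_one, div_inv_eq_mul]
      rw [mul_right_comm, inv_mul_cancel, one_mul]
  | left m i j hij =>
    have hμ := μ.left m i j hij
    have hs : v ^ sgn (μ.val (m + 1) j) = (v ^ sgn (μ.val (m + 1) i))⁻¹ := by
      rw [hμ, sgn_add_one, _root_.zpow_neg, inv_inv]
    refine ⟨Pi.mulSingle ⟨m + 1, i⟩ (v ^ sgn (μ.val (m + 1) i)) *
      Pi.mulSingle ⟨m + 1, j⟩ (v ^ sgn (μ.val (m + 1) i)), 1, 1, fun m' i' j' h' => ?_,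
      fun m' i' j' h' => ?_, fun m' i' j' h' => by simp, ?_⟩
    · by_cases hm : m' = m
      · subst hm
        have := h'.ne_of_leftCuspAt hij
        rw [Pi.mul_apply, mulSingle_strand_apply, mulSingle_strand_apply, if_neg this.1.symm,
          if_neg this.2.symm]
        simp
      · rw [Pi.mul_apply, mulSingle_strand_apply_of_ne (hne hm),
          mulSingle_strand_apply_of_ne (hne hm)]
        simp
    · by_cases hm : m' = m
      · subst hm
        obtain ⟨rfl, rfl⟩ := h'.unique hij
        simp only [Pi.mul_apply, mulSingle_strand_apply, if_neg hij.ne, if_neg hij.ne.symm,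
          if_true, one_mul, mul_one]
      · simp only [Pi.mul_apply, mulSingle_strand_apply_of_ne (hne hm)]
    · simp only [siteCoeffs, hs, Pi.mulSingle_inv, Prod.mk_mul_mk, mul_one, one_div, mul_inv]
      rw [mul_right_comm, inv_mul_cancel, one_mul]
  | right m i j hij =>
    have hμ := μ.right m i j hij
    have hs : v ^ sgn (μ.val m j) = (v ^ sgn (μ.val m i))⁻¹ := by
      rw [hμ, sgn_add_one, _root_.zpow_neg, inv_inv]
    refine ⟨1, Pi.mulSingle ⟨m, i⟩ (v ^ sgn (μ.val m i))⁻¹ *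
      Pi.mulSingle ⟨m, j⟩ (v ^ sgn (μ.val m i))⁻¹, 1, fun m' i' j' h' => ?_,
      fun m' i' j' h' => rfl, fun m' i' j' h' => ?_, ?_⟩
    · by_cases hm : m' = m
      · subst hm
        have := h'.ne_of_rightCuspAt hij
        rw [Pi.mul_apply, mulSingle_strand_apply, mulSingle_strand_apply, if_neg this.1.symm,
          if_neg this.2.symm]
        simp
      · rw [Pi.mul_apply, mulSingle_strand_apply_of_ne hm, mulSingle_strand_apply_of_ne hm]
        simp
    · by_cases hm : m' = m
      · subst hm
        obtain ⟨rfl, rfl⟩ := h'.unique hij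
        simp only [Pi.mul_apply, mulSingle_strand_apply, if_neg hij.ne, if_neg hij.ne.symm,
          if_true, one_mul, mul_one, Pi.one_apply]
      · simp only [Pi.mul_apply, mulSingle_strand_apply_of_ne hm, Pi.one_apply, one_mul]
    · simp only [siteCoeffs, hs, Pi.mulSingle_inv, Prod.mk_mul_mk, mul_one, div_one]
      rw [mul_right_comm, inv_mul_cancel, one_mul]

theorem movable_of_sameComponent (μ : D.MaslovPotential r) {p q : D.Strand}
    (h : D.SameComponent p q) : Movable F μ (.strand p.1 p.2) (.strand q.1 q.2) := by
  induction h with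
  | rel p q h => exact movable_of_adj μ h
  | refl p => exact fun _ _ h => h
  | symm p q _ ih => exact ih.symm
  | trans p q z _ _ ih₁ ih₂ => exact ih₁.trans ih₂

theorem movable_toStrand (μ : D.MaslovPotential r) (x : D.Site) :
    Movable F μ (.strand x.toStrand.1 x.toStrand.2) x := by
  cases x with
  | strand m i => exact fun _ _ h => h
  | loop m i j hij =>
    -- A gauge on the upper strand alone breaks the balance at the cusp by exactly the factor that
    -- `κ` puts on the loop.
    refine Movable.of_gauge fun v => ⟨1, Pi.mulSingle ⟨m, i⟩ (v ^ sgn (μ.val m i))⁻¹,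
      Pi.mulSingle m (v ^ sgn (μ.val m i)), fun m' i' j' h' => ?_,
      fun m' i' j' h' => rfl, fun m' i' j' h' => ?_, ?_⟩
    · by_cases hm : m' = m
      · subst hm
        rw [mulSingle_strand_apply, if_neg (h'.ne_of_rightCuspAt hij).1.symm]
        simp
      · rw [mulSingle_strand_apply_of_ne hm]
        simp
    · by_cases hm : m' = m
      · subst hm
        obtain ⟨rfl, rfl⟩ := h'.unique hij
        simp [hij.ne.symm]
      · simp [mulSingle_strand_apply_of_ne hm, Pi.mulSingle_eq_of_ne hm]
    · simp [siteCoeffs, Site.toStrand, Pi.mulSingle_inv]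

/-- All coefficients can be moved to base points on the same components. -/
theorem IsAugmentable.move {μ : D.MaslovPotential r} {s : ℕ} (P : D.BasePoints s)
    (b : D.Strand → Fin s) (hb : ∀ p, D.SameComponent p (P.pos (b p)).toStrand)
    (v : D.Strand → Fˣ)
    (h : IsAugmentable μ (∏ p : D.Strand, siteCoeffs μ (.strand p.1 p.2) (v p))) :
    IsAugmentable μ (∏ p : D.Strand, siteCoeffs μ (P.pos (b p)) (v p)) := by
  -- The arbitrary factor `g` holds the coefficients that stay fixed while those over `S` move.
  have key : ∀ (S : Finset D.Strand) (g : D.Coeffs F),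
      IsAugmentable μ ((∏ p ∈ S, siteCoeffs μ (.strand p.1 p.2) (v p)) * g) →
      IsAugmentable μ ((∏ p ∈ S, siteCoeffs μ (P.pos (b p)) (v p)) * g) := by
    intro S
    induction S using Finset.induction_on with
    | empty => exact fun g hg => hg
    | insert p S hp ih =>
      intro g hg
      rw [Finset.prod_insert hp, mul_right_comm, mul_comm] at hg
      have := (movable_of_sameComponent μ (hb p)).trans (movable_toStrand μ _) (v p) _
        (by rw [mul_left_comm]; exact ih _ hg)
      rw [Finset.prod_insert hp, mul_assoc]
      exact this
  simpa using key Finset.univ 1 (by simpa using h)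

/-- A ruling gives a solution whose coefficient at a given self-paired strand is arbitrary. -/
theorem GeneralizedNormalRuling.exists_isAugmentable (R : D.GeneralizedNormalRuling)
    (μ : D.MaslovPotential r) (m₀ : Fin (D.M + 1)) (i₀ : Fin (D.N m₀)) (h₀ : R.σ m₀ i₀ = i₀) :
    ∃ t : D.Strand → Fˣ, ∀ c : Fˣ, IsAugmentable μ (F := F) (t * Pi.mulSingle ⟨m₀, i₀⟩ c, 1) := by
  have key := fun m => Event.exists_step_of_rulingStep (F := F) (R.involutive m)
    (R.involutive (m + 1)) (R.step m) (fun i => sgnUnit F (μ.val m i))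
    (fun i => sgnUnit F (μ.val (m + 1) i)) (fun i j h => congrArg (sgnUnit F) (μ.through m i j h))
  choose t a A' B hB hA hc using key
  -- One solution serves every `c`: the coefficient of the self-paired strand meets only zero
  -- entries.
  refine ⟨fun p => t p.1 p.2, fun c => ⟨a, fun m => rulingMatrix (R.σ m)
    (fun i => sgnUnit F (μ.val m i)), A', B, fun m => ⟨rulingMatrix_strictUpper _ _,
    rulingMatrix_mul_self (R.involutive m) _, hB m, ?_, hc m⟩⟩⟩
  suffices hconj : diagConj (fun i => ((fun p => t p.1 p.2) * Pi.mulSingle ⟨m₀, i₀⟩ c :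
      D.Strand → Fˣ) ⟨m, i⟩) (rulingMatrix (R.σ m) fun i => sgnUnit F (μ.val m i)) =
      diagConj (t m) (rulingMatrix (R.σ m) fun i => sgnUnit F (μ.val m i)) by
    exact hconj ▸ hA m
  refine diagConj_rulingMatrix_congr _ (R.involutive m) _ _ _ fun i hi => ?_
  rw [Pi.mul_apply]
  by_cases hm : m = m₀
  · subst hm
    rw [mulSingle_strand_apply, if_neg (by rintro rfl; exact hi h₀), mul_one]
  · rw [mulSingle_strand_apply_of_ne hm, mul_one]

/-- The orientation sign is `±1`, so applying it twice as an exponent recovers `t p`. -/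
theorem prod_siteCoeffs_strand (μ : D.MaslovPotential r) (t : D.Strand → Fˣ) :
    ∏ p : D.Strand, siteCoeffs μ (.strand p.1 p.2) (t p ^ sgn (μ.val p.1 p.2)) = (t, 1) := by
  simp only [siteCoeffs, ← _root_.zpow_mul, sgn_mul_self, zpow_one]
  ext1
  · rw [Prod.fst_prod]
    exact Finset.univ_prod_mulSingle t
  · simp [Prod.snd_prod]

/-- The values of the base points `t` on strands and loops. -/
noncomputable def baseCoeffs {s : ℕ} (μ : D.MaslovPotential r) (P : D.BasePoints s)
    (t : Fin s → Fˣ) : D.Coeffs F :=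
  (fun p => ∏ q, t q ^ strandExp μ P p.1 p.2 q, fun m => ∏ q, t q ^ loopExp μ P m q)

theorem prod_siteCoeffs_pos {s : ℕ} (μ : D.MaslovPotential r) (P : D.BasePoints s)
    (t : Fin s → Fˣ) : ∏ q, siteCoeffs μ (P.pos q) (t q) = baseCoeffs μ P t := by
  refine Prod.ext (funext fun p => ?_) (funext fun m => ?_)
  · rw [Prod.fst_prod, Finset.prod_apply]
    refine Finset.prod_congr rfl fun q _ => ?_
    unfold strandExp
    cases hq : P.pos q with
    | strand m i =>
      obtain ⟨m', i'⟩ := p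
      by_cases h : m = m'
      · subst h
        by_cases hi : i = i'
        · subst hi; simp [siteCoeffs]
        · simp [siteCoeffs, hi, Ne.symm hi]
      · simp [siteCoeffs, h]
    | loop m i j hij => simp [siteCoeffs]
  · rw [Prod.snd_prod, Finset.prod_apply]
    refine Finset.prod_congr rfl fun q _ => ?_
    unfold loopExp
    cases hq : P.pos q with
    | strand m' i => simp [siteCoeffs]
    | loop m' i j hij =>
      by_cases h : m' = m
      · subst h; simp [siteCoeffs]
      · simp [siteCoeffs, h]

/-- A strictly generalized normal ruling gives solutions with any product of the base points. -/
theorem GeneralizedNormalRuling.IsStrict.exists_isAugmentable {R : D.GeneralizedNormalRuling}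
    (hR : R.IsStrict) (μ : D.MaslovPotential r) {s : ℕ} (P : D.BasePoints s) (x : Fˣ) :
    ∃ t : Fin s → Fˣ, ∏ q, t q = x ∧ IsAugmentable μ (baseCoeffs μ P t) := by
  obtain ⟨m₀, i₀, h₀⟩ := hR
  obtain ⟨t₀, ht₀⟩ := R.exists_isAugmentable (F := F) μ m₀ i₀ h₀
  choose b hb using P.exists_mem
  let w : Fˣ := ∏ p : D.Strand, t₀ p ^ sgn (μ.val p.1 p.2)
  -- The oriented product must change from `w` to `x`; the outer exponent undoes the orientation
  -- sign of the strand.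
  let y : Fˣ := (x * w⁻¹) ^ sgn (μ.val m₀ i₀)
  let t₁ : D.Strand → Fˣ := t₀ * Pi.mulSingle ⟨m₀, i₀⟩ y
  let v : D.Strand → Fˣ := fun p => t₁ p ^ sgn (μ.val p.1 p.2)
  have hv : ∏ p, v p = x := by
    have : ∀ p, v p = t₀ p ^ sgn (μ.val p.1 p.2) *
        (Pi.mulSingle (⟨m₀, i₀⟩ : D.Strand) (x * w⁻¹) : D.Strand → Fˣ) p := by
      intro p
      simp only [v, t₁, Pi.mul_apply, mul_zpow]
      congr 1
      by_cases hp : p = ⟨m₀, i₀⟩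
      · subst hp
        simp [y, ← _root_.zpow_mul, sgn_mul_self]
      · simp [Pi.mulSingle_eq_of_ne hp]
    rw [Finset.prod_congr rfl fun p _ => this p, Finset.prod_mul_distrib,
      Finset.prod_pi_mulSingle']
    simp [w]
  -- Each base point receives the product of the values of all strands assigned to it by `b`.
  refine ⟨fun q => ∏ p with b p = q, v p, ?_, ?_⟩
  · rw [Finset.prod_fiberwise, hv]
  · have h₁ : IsAugmentable μ (∏ p : D.Strand, siteCoeffs μ (.strand p.1 p.2) (v p)) := by
      rw [prod_siteCoeffs_strand]
      exact ht₀ y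
    have h₂ := h₁.move P b hb
    rw [← prod_siteCoeffs_pos]
    convert h₂ using 1
    rw [← Finset.prod_fiberwise Finset.univ b]
    refine Finset.prod_congr rfl fun q _ => ?_
    have hom : ∀ S : Finset D.Strand, siteCoeffs μ (P.pos q) (∏ p ∈ S, v p) =
        ∏ p ∈ S, siteCoeffs μ (P.pos q) (v p) := fun S => by
      induction S using Finset.induction_on with
      | empty => exact siteCoeffs_one _ _
      | insert p S hp ih => rw [Finset.prod_insert hp, Finset.prod_insert hp, siteCoeffs_mul, ih]
    rw [hom]
    refine Finset.prod_congr rfl fun p hp => ?_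
    rw [(Finset.mem_filter.mp hp).2]

end Front

/-! ### Evaluation of the differential at an event -/

namespace Event

variable {F : Type*} [Field F] {A : Type} [Ring A] (ε : A →+* F) {n n' : ℕ} {e : Event n n'}
  {a τ : F} {s : Fin n → Fˣ} {s' : Fin n' → Fˣ} {X : Matrix (Fin n) (Fin n) F}
  {X' : Matrix (Fin n') (Fin n') F} {C : Matrix (Fin n) (Fin n) A}

theorem Step.map_boundary (hX : e.Step a τ s s' X X') (hs : ∀ i, (s i : F) * s i = 1)
    (hC : ∀ i j, ε (C i j) = s i * X i j) {τA : A} (hτ : ε τA = τ) :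
    ε (e.boundary τA C) = 0 := by
  cases e with
  | crossing n k => simp [boundary, hC, hX.1]
  | rightCusp n k =>
    simp only [boundary, map_add, hτ, hC, hX.2.1]
    linear_combination (-τ) * hs k.castSucc
  | _ => simp [boundary]

theorem Step.map_outgoing (hX : e.Step a τ s s' X X') (hs : ∀ i, (s i : F) * s i = 1)
    (hss : ∀ i j, e.Through i j → s' j = s i) (hs' : ∀ i, (s' i : F) * s' i = 1)
    (hC : ∀ i j, ε (C i j) = s i * X i j) {aA τA : A} (ha : e.HasGenerator → ε aA = a) {r : ℕ}
    {μ : Fin n → ZMod (2 * r)} (hμ : ∀ i, (s i : F) = sgn (μ i)) (i j : Fin n') :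
    ε (e.outgoing aA (sgn (e.degree μ)) τA C i j) = s' i * X' i j := by
  cases e with
  | trivial n =>
    rw [show X' = X from hX, hss i i rfl]
    exact hC i j
  | crossing n k =>
    obtain ⟨h₀, rfl⟩ := hX
    have ha := ha True.intro
    have hst : ∀ i, s' i = s (transp k i) := fun i => hss _ _ (transp_transp k i).symm
    have hpq : k.castSucc ≠ k.succ := Fin.castSucc_lt_succ.ne
    simp only [outgoing]
    set U : Matrix (Fin (n + 2)) (Fin (n + 2)) A := fun i j =>
        if i = k.castSucc then (if j = k.succ then 1 else 0)
        else if i = k.succ then (if j = k.castSucc then 1 else if j = k.succ then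
          -(sgn ((crossing n k).degree μ) • aA) else 0)
        else if i = j then 1 else 0 with hU
    set V : Matrix (Fin (n + 2)) (Fin (n + 2)) A := fun i j =>
        if i = k.castSucc then (if j = k.castSucc then aA else if j = k.succ then 1 else 0)
        else if i = k.succ then (if j = k.castSucc then 1 else 0)
        else if i = j then 1 else 0 with hV
    set Ch := C.updateRow k.castSucc (Function.update (C k.castSucc) k.succ 0) with hCh
    have e₂ : Ch.map ε = diagonal (fun i => (s i : F)) * X := by
      ext i j
      rw [Matrix.diagonal_mul, Matrix.map_apply, ← hC, hCh]
      by_cases hi : i = k.castSucc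
      · subst hi
        by_cases hj : j = k.succ
        · subst hj; simp [hC, h₀]
        · simp [hj]
      · rw [Matrix.updateRow_ne hi]
    -- The sign `(-1)^{|a|}` equals `s k.castSucc * s k.succ`, which is what moving the diagonal
    -- signs from the right of `U` to its left requires.
    have e₁ : U.map ε * diagonal (fun i => (s i : F)) = diagonal (fun i => (s' i : F)) *
        (transvection k.castSucc k.succ (-a)).submatrix (transp k) id := by
      ext i j
      rw [Matrix.mul_diagonal, Matrix.diagonal_mul, Matrix.map_apply, hst, hU]
      simp only [Matrix.submatrix_apply, id, transvection, Matrix.add_apply]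
      rcases eq_or_ne i k.castSucc with rfl | h₁
      · by_cases hj : j = k.succ
        · subst hj; simp [transp_apply_castSucc, hpq, Matrix.one_apply]
        · simp [transp_apply_castSucc, hpq, hj, Ne.symm hj]
      · rcases eq_or_ne i k.succ with rfl | h₂
        · by_cases hj : j = k.castSucc
          · subst hj; simp [transp_apply_succ, hpq.symm, Matrix.one_apply]
          · by_cases hj' : j = k.succ
            · subst hj'
              simp only [transp_apply_succ, hpq.symm, hpq, if_true, if_false, degree, sgn_sub,
                map_neg, zsmul_eq_mul, map_mul, map_intCast, ha, Int.cast_mul, Matrix.one_apply,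
                Matrix.single_apply_same, zero_add]
              rw [← hμ, ← hμ]
              linear_combination (-(s k.castSucc : F) * a) * hs k.succ
            · simp [transp_apply_succ, hpq.symm, hj, hj', Ne.symm hj, Ne.symm hj']
        · rw [transp_apply_of_ne k h₁ h₂]
          by_cases hij : i = j
          · subst hij; simp [h₁, h₂, h₁.symm]
          · simp [h₁, h₂, h₁.symm, hij]
    have e₃ : V.map ε = (transvection k.castSucc k.succ a).submatrix id (transp k) := by
      ext i j
      rw [Matrix.map_apply, hV]
      simp only [Matrix.submatrix_apply, id, transvection, Matrix.add_apply]
      rcases eq_or_ne j k.castSucc with rfl | h₁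
      · rcases eq_or_ne i k.castSucc with rfl | h₃
        · simp [transp_apply_castSucc, ha, hpq]
        · simp [transp_apply_castSucc, h₃, Ne.symm h₃, Matrix.one_apply, apply_ite ε]
      · rcases eq_or_ne j k.succ with rfl | h₂
        · rcases eq_or_ne i k.castSucc with rfl | h₃
          · simp [transp_apply_succ, hpq.symm, Matrix.one_apply]
          · simp only [transp_apply_succ, h₃, hpq.symm, if_false, Matrix.one_apply,
              Matrix.single_apply, Ne.symm h₃, false_and, add_zero]
            split_ifs <;> simp
        · rw [transp_apply_of_ne k h₁ h₂]
          rcases eq_or_ne i k.castSucc with rfl | h₃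
          · simp [h₁, h₂, h₁.symm, h₂.symm]
          · rcases eq_or_ne i k.succ with rfl | h₄
            · simp [h₁, h₂.symm, h₃]
            · simp [h₃, h₄, Ne.symm h₃, Matrix.one_apply, apply_ite ε]
    have e₄ : (U * Ch * V).map ε = diagonal (fun i => (s' i : F)) *
        (transvection k.castSucc k.succ (-a) * X *
          transvection k.castSucc k.succ a).submatrix (transp k) (transp k) := by
      rw [Matrix.map_mul, Matrix.map_mul, e₂, e₃, ← mul_assoc, e₁, mul_assoc, mul_assoc,
        Matrix.submatrix_mul _ _ _ id _ Function.bijective_id,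
        Matrix.submatrix_mul _ _ _ id _ Function.bijective_id, Matrix.submatrix_id_id, mul_assoc]
    rw [← Matrix.map_apply (f := ε) (M := U * Ch * V), e₄, Matrix.diagonal_mul]
  | leftCusp n k =>
    obtain ⟨h₁, h₂, h₃, h₄, h₅, h₆⟩ := hX
    have hpq : k.castSucc ≠ k.succ := Fin.castSucc_lt_succ.ne
    simp only [outgoing, Matrix.add_apply, map_add]
    set J : Matrix (Fin (n + 2)) (Fin n) A := fun i j => if i = skip k j then 1 else 0 with hJ
    have j₁ : ∀ l, J k.castSucc l = 0 := fun l => if_neg (skip_ne_castSucc k l).symm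
    have j₂ : ∀ l, J k.succ l = 0 := fun l => if_neg (skip_ne_succ k l).symm
    have j₃ : ∀ i l, J (skip k i) l = if i = l then 1 else 0 := fun i l => by
      simp [hJ, (skip_injective k).eq_iff]
    rcases eq_castSucc_or_eq_succ_or_eq_skip k i with rfl | rfl | ⟨i, rfl⟩
    · rw [Matrix.mul_apply, Finset.sum_eq_zero fun l _ => by simp [Matrix.mul_apply, j₁], map_zero,
        zero_add]
      by_cases hj : j = k.succ
      · subst hj; simp [h₂, hs']
      · simp [h₃ j hj, Ne.symm hj]
    · rw [Matrix.mul_apply, Finset.sum_eq_zero fun l _ => by simp [Matrix.mul_apply, j₂], map_zero,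
        zero_add]
      simp [h₄, hpq]
    · have hi₁ := skip_ne_castSucc k i
      have hi₂ := skip_ne_succ k i
      rw [Matrix.single_apply, if_neg (by rintro ⟨h, -⟩; exact hi₁ h.symm), map_zero, add_zero,
        Matrix.mul_apply]
      rcases eq_castSucc_or_eq_succ_or_eq_skip k j with rfl | rfl | ⟨j, rfl⟩
      · simp [j₁, h₅]
      · simp [j₂, h₆ _ hi₁]
      · simp [Matrix.mul_apply, j₃, h₁, hC, hss i _ rfl]
  | rightCusp n k =>
    obtain ⟨h₀, h₁, h₂, rfl⟩ := hX
    have ha := ha True.intro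
    simp [outgoing, hC, ha, h₀, h₂, hss (skip k i) i rfl]

end Event

/-! ### Ring homomorphisms from the DGA -/

/-- The evaluation of Laurent polynomials at `t`. -/
noncomputable def laurentEval {F : Type*} [Field F] {s : ℕ} (t : Fin s → Fˣ) : Laurent s →+* F :=
  (AddMonoidAlgebra.lift ℤ F (Fin s → ℤ)
    { toFun := fun v => ((∏ q, t q ^ v.toAdd q : Fˣ) : F)
      map_one' := by simp
      map_mul' := fun v w => by
        rw [← Units.val_mul, ← Finset.prod_mul_distrib]
        simp only [toAdd_mul, Pi.add_apply, _root_.zpow_add] } : Laurent s →ₐ[ℤ] F)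

theorem laurentEval_mono {F : Type*} [Field F] {s : ℕ} (t : Fin s → Fˣ) (v : Fin s → ℤ) :
    laurentEval t (mono v) = ((∏ q, t q ^ v q : Fˣ) : F) := by
  simp [laurentEval, mono]

theorem laurentEval_tVar {F : Type*} [Field F] {s : ℕ} (t : Fin s → Fˣ) (q : Fin s) :
    laurentEval t (tVar q) = t q := by
  rw [tVar, laurentEval_mono, Finset.prod_eq_single q]
  · simp
  · intro b _ hb
    simp [hb]
  · simp

/-- A ring homomorphism from a free algebra with given values on coefficients and generators. -/
theorem exists_ringHom_freeAlgebra {R X : Type} [CommRing R] {F : Type*} [Field F] (φ : R →+* F)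
    (f : X → F) : ∃ ε : FreeAlgebra R X →+* F, (∀ g, ε (FreeAlgebra.ι R g) = f g) ∧
      ∀ c, ε (algebraMap R _ c) = φ c := by
  let := φ.toAlgebra
  exact ⟨(FreeAlgebra.lift R f : FreeAlgebra R X →ₐ[R] F), fun g => by simp,
    fun c => by simp [RingHom.algebraMap_toAlgebra]⟩

/-- A ring homomorphism vanishes on boundaries if it does so on the boundaries of the generators. -/
theorem map_extend_eq_zero {R X : Type} [CommRing R] {F : Type*} [Field F] (sg : X → ℤ)
    (d : X → FreeAlgebra R X) (ε : FreeAlgebra R X →+* F) (h : ∀ g, ε (d g) = 0)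
    (x : FreeAlgebra R X) : ε (extend sg d x) = 0 := by
  induction x using FreeAlgebra.induction with
  | grade0 c => rw [extend_algebraMap, map_zero]
  | grade1 g => rw [extend_ι, h]
  | mul a b ha hb => rw [extend_mul, map_add, map_mul, map_mul, ha, hb, zero_mul, mul_zero, add_zero]
  | add a b ha hb => rw [extend_add, map_add, ha, hb, add_zero]

namespace Front

variable {D : Front} {r s : ℕ} {F : Type*} [Field F]

/-- Solutions of the equations of an augmentation define augmentations. -/
theorem IsAugmentable.exists_isAugmentation {μ : D.MaslovPotential r} {P : D.BasePoints s}
    {t : Fin s → Fˣ} (h : IsAugmentable μ (baseCoeffs μ P t)) :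
    ∃ ε : D.Alg s →+* F, IsAugmentation μ P ε ∧
      ∀ c, ε (algebraMap (Laurent s) (D.Alg s) c) = laurentEval t c := by
  obtain ⟨a, A, A', B, H⟩ := h
  obtain ⟨ε, hε, hc⟩ := exists_ringHom_freeAlgebra (laurentEval t) (X := D.Gen) (fun
    | .a m _ => a m
    | .b m i j _ => B m i j
    -- `A = Σ C` and `Σ² = 1` give `C = Σ A`.
    | .c m i j _ => sgnUnit F (μ.val m i) * A m i j)
  refine ⟨ε, map_extend_eq_zero _ _ ε ?_, hc⟩
  have hsq : ∀ m i, (sgnUnit F (μ.val m i) : F) * sgnUnit F (μ.val m i) = 1 := fun m i => by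
    rw [coe_sgnUnit, ← Int.cast_mul, sgn_mul_self, Int.cast_one]
  have hC : ∀ m i j, ε (D.matC s m i j) = sgnUnit F (μ.val m i) * A m i j := fun m i j => by
    unfold matC
    split_ifs with hij
    · rw [hε]
    · rw [map_zero, (H m).1 i j hij, mul_zero]
  have hB : ∀ m, (D.matB s m).map ε = B m := fun m => by
    ext i j
    rw [Matrix.map_apply, matB]
    split_ifs with hij
    · rw [hε]
    · rw [map_zero, (H m).2.2.1 i j hij]
  have hS : ∀ m, (matSigma μ s m).map ε =
      diagonal fun i => (sgnUnit F (μ.val m i) : F) := fun m => by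
    rw [matSigma, Matrix.diagonal_map (map_zero ε)]
    congr 1
    ext i
    simp [coe_sgnUnit]
  have hSS : ∀ m, (diagonal fun i => (sgnUnit F (μ.val m i) : F)) *
      diagonal (fun i => (sgnUnit F (μ.val m i) : F)) = 1 := fun m => by
    rw [Matrix.diagonal_mul_diagonal, ← Matrix.diagonal_one]
    congr 1
    ext i
    exact hsq m i
  have hCm : ∀ m, (D.matC s m).map ε =
      (diagonal fun i => (sgnUnit F (μ.val m i) : F)) * A m := fun m => by
    ext i j
    rw [Matrix.map_apply, hC, Matrix.diagonal_mul]
  have hbC : ∀ m i j, ε (basedC μ P m i j) = sgnUnit F (μ.val m i) *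
      diagConj (fun i => (baseCoeffs μ P t).1 ⟨m, i⟩) (A m) i j := fun m i j => by
    rw [basedC, Algebra.smul_def, map_mul, hc, hC, laurentEval_mono, diagConj_apply]
    have : ∏ q, t q ^ (strandExp μ P m j - strandExp μ P m i) q =
        ((baseCoeffs μ P t).1 ⟨m, i⟩)⁻¹ * (baseCoeffs μ P t).1 ⟨m, j⟩ := by
      simp only [baseCoeffs, Pi.sub_apply, _root_.zpow_sub, Finset.prod_mul_distrib,
        Finset.prod_inv_distrib]
      rw [mul_comm]
    rw [this, Units.val_mul]
    ring
  intro g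
  cases g with
  | a m h =>
    refine (H m).2.2.2.1.map_boundary ε (hsq m) (hbC m) ?_
    rw [hc, laurentEval_mono]
    rfl
  | b m i j hij =>
    have ht : (tildeC μ P m).map ε =
        (diagonal fun i => (sgnUnit F (μ.val (m + 1) i) : F)) * A' m := by
      ext i j
      rw [Matrix.map_apply, Matrix.diagonal_mul]
      refine (H m).2.2.2.1.map_outgoing ε (hsq m)
        (fun i j h => congrArg (sgnUnit F) (μ.through m i j h)) (hsq (m + 1)) (hbC m)
        (fun h => ?_) (fun i => coe_sgnUnit F _) i j
      rw [aGen, dif_pos h, hε]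
    have hB' : (1 + D.matB s m).map ε = 1 + B m := by
      rw [Matrix.map_add ε (map_add ε), hB, Matrix.map_one ε (map_zero ε) (map_one ε)]
    rw [diffGen, ← Matrix.map_apply (f := ε) (M := _ + _), Matrix.map_add ε (map_add ε),
      Matrix.map_neg ε (map_neg ε)]
    simp only [Matrix.map_mul, hB', ht, hS, hCm]
    have hS' := hSS (m + 1)
    set S := diagonal fun i => (sgnUnit F (μ.val (m + 1) i) : F)
    -- The vanishing of `∂B` is the relation `A' (1 + B) = (1 + B) A` multiplied by `Σ` on the left.
    have : S * (1 + B m) * S * (S * A (m + 1)) = S * A' m * (1 + B m) := by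
      rw [mul_assoc (S * (1 + B m)), ← mul_assoc S S, hS', one_mul, mul_assoc, mul_assoc,
        (H m).2.2.2.2]
    rw [this, neg_add_cancel, Matrix.zero_apply]
  | c m i j hij =>
    have : (matSigma μ s m * D.matC s m).map ε = A m := by
      rw [Matrix.map_mul, hS, hCm, ← mul_assoc, hSS, one_mul]
    rw [diffGen, ← Matrix.map_apply (f := ε) (M := _ ^ 2), sq, Matrix.map_mul, this, (H m).2.1,
      Matrix.zero_apply]

end Front

end SolidTorus

theorem mainTheorem8 (D : SolidTorus.Front) (r : ℕ) (μ : D.MaslovPotential r)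
    (s : ℕ) (P : D.BasePoints s)
    (R : D.GeneralizedNormalRuling) (hR : R.IsStrict)
    {F : Type*} [Field F] (x : F) (hx : x ≠ 0) :
    ∃ ε : D.Alg s →+* F, SolidTorus.Front.IsAugmentation μ P ε ∧
      ε (algebraMap (SolidTorus.Laurent s) (D.Alg s) (∏ q : Fin s, SolidTorus.tVar q)) = x := by
  obtain ⟨t, ht, h⟩ := hR.exists_isAugmentable μ P (Units.mk0 x hx)
  obtain ⟨ε, hε, hc⟩ := h.exists_isAugmentation
  refine ⟨ε, hε, ?_⟩
  rw [hc, map_prod, Finset.prod_congr rfl fun q _ => SolidTorus.laurentEval_tVar t q,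
    ← Units.coe_prod, ht, Units.val_mk0]
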